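/- A finite Markov decision process (MDP) $\mathcal M=(S,\mathrm{Act},P,\mathit{init})$ has finite sets $S$ of states and $\mathrm{Act}$ of actions, an initial state $\mathit{init}$, and $P:S\times \mathrm{Act}\times S\to[0,1]$ with $\sum_t P(s,\alpha,t)\in\{0,1\}$; $\alpha$ is enabled in $s$ if this sum is $1$, and $s$ is terminal if no action is enabled in it. A policy maps every finite path that does not end in a terminal state to a probability distribution on the actions enabled in its last state; $\Pr^{\sigma}$ is the induced probability measure on maximal paths from $\mathit{init}$. A policy $\sigma$ is a global probability-raising (GPR) policy for $C$ and $E$ if $\Pr^{\sigma}(\Diamond C)>0$ and $\Pr^{\sigma}(\Diamond E\mid \Diamond C)>\Pr^{\sigma}(\Diamond E)$. Let $\mathcal M_0$ be a finite MDP, $E_0$ a set of terminal states of $\mathcal M_0$, and $C_0$ a set of states disjoint from $E_0$. The canonical MDP $\mathcal M$ of $\mathcal M_0$ for $C_0$ and $E_0$ is obtained as follows. (i) In each $c\in C_0$ all actions are replaced by two new actions $\alpha_{\min},\alpha_{\max}$, which lead to a new terminal state $\mathit{TP}$ with the minimal, respectively maximal, probability (over all policies of $\mathcal M_0$) of reaching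 $E_0$ from $c$, and to a new terminal state $\mathit{FP}$ with the remaining probability. (ii) Each maximal end component is collapsed to one state, whose actions are the enabled actions of its states that are not part of the maximal end component. (iii) The states of $E_0$ are collapsed to one new terminal state $\mathit{FN}$, the terminal states other than $\mathit{TP}$, $\mathit{FP}$ and those of $E_0$ are collapsed to one new terminal state $\mathit{TN}$, and each state that represents a maximal end component gets a new action $\tau$ leading to $\mathit{TN}$ with probability $1$. Thus $\mathcal M$ has no end components, and its terminal states are exactly $\mathit{TP},\mathit{FP},\mathit{FN},\mathit{TN}$. Let $C$ be the set of states of $\mathcal M$ that come from $C_0$, and let $E=\{\mathit{TP},\mathit{FN}\}$. **Lemma 18 (Quadratic program for GPR policies).** There is a GPR policy for $C$ and $E$ in the canonical MDP $\mathcal M$ if and only if the following system, with a real variable $x_{s,\alpha}$ for every state $s$ of $\mathcal M$ and action $\alpha$ enabled in $s$, and a real variable $x_t$ for every terminal state $t$ of $\mathcal M$, has a solution, where $x_s=\sum_{\alpha\text{ enabled in }s}x_{s,\alpha}$ for non-terminal $s$: - (S1) $x_{s,\alpha}\ge 0$ for all state-action pairs $(s,\alpha)$; - (S2) $x_{\mathit{init}}=1+\sum_{(t,\alpha)}x_{t,\alpha}\,P(t,\alpha,\mathit{init})$;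 - (S3) $x_s=\sum_{(t,\alpha)}x_{t,\alpha}\,P(t,\alpha,s)$ for all states $s\neq \mathit{init}$; - $x_{\mathit{TP}}\cdot x_{\mathit{TN}}-x_{\mathit{FP}}\cdot x_{\mathit{FN}}>0$. Here $\mathit{init}$ and $P$ are the initial state and transition function of $\mathcal M$, and the sums run over all state-action pairs $(t,\alpha)$ of $\mathcal M$. -/

import Mathlib

open MeasureTheory ProbabilityTheory

/-- A finite Markov decision process with states `S` and actions `A`. -/
structure MDP (S A : Type*) [Fintype S] [Fintype A] where
  P : S → A → S → ℝ
  init : S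
  P_nonneg : ∀ s a t, 0 ≤ P s a t
  P_sum : ∀ s a, ∑ t, P s a t = 0 ∨ ∑ t, P s a t = 1

/-- One step of a run: the action that was just taken (`none` at time `0`, and when the run
has already stopped in a terminal state) and the state that the run is in now. -/
structure PathStep (S A : Type*) where
  act : Option A
  state : S

instance {S A : Type*} : MeasurableSpace (PathStep S A) := ⊤

instance {S A : Type*} : MeasurableSingletonClass (PathStep S A) :=
  ⟨fun _ => MeasurableSpace.measurableSet_top⟩

instance {S A : Type*} [Fintype S] [Fintype A] : Finite (PathStep S A) :=
  Finite.of_injective (fun x : PathStep S A => (x.act, x.state)) (by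
    rintro ⟨a, s⟩ ⟨b, t⟩ h
    simp only [Prod.mk.injEq] at h
    obtain ⟨rfl, rfl⟩ := h
    rfl)

/-- The finite path `s₀ α₀ s₁ … αₙ₋₁ sₙ`: entry `0` is `(none, s₀)` and entry `i + 1`
is `(some αᵢ, sᵢ₊₁)`. -/
abbrev History (S A : Type*) (n : ℕ) : Type _ := (i : Finset.Iic n) → PathStep S A

/-- The last state of a finite path. -/
def History.last {S A : Type*} {n : ℕ} (h : History S A n) : S :=
  (h ⟨n, Finset.mem_Iic.2 le_rfl⟩).state

namespace MDP

section Basic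

variable {S A : Type*} [Fintype S] [Fintype A] (M : MDP S A)

/-- Action `a` is enabled in state `s`. -/
def Enabled (s : S) (a : A) : Prop := ∑ t, M.P s a t = 1

/-- A state without enabled actions. -/
def IsTerminal (s : S) : Prop := ∀ a, ¬ M.Enabled s a

/-- A (history-dependent, randomized) policy: a distribution over the enabled actions of the last
state, for each finite path that does not end in a terminal state.
At a path that ends in a terminal state all values are `0`. -/
structure Policy where
  prob : (n : ℕ) → History S A n → A → ℝ
  nonneg : ∀ n h a, 0 ≤ prob n h a
  enabled : ∀ n h a, prob n h a ≠ 0 → M.Enabled (History.last h) a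
  sum_one : ∀ n h, ¬ M.IsTerminal (History.last h) → ∑ a, prob n h a = 1

variable {M}

open Classical in
/-- The law of the next step after a finite path. In a terminal state the path is over, which is
encoded by repeating that state forever (with action `none`). -/
noncomputable def Policy.stepMeasure (σ : M.Policy) {n : ℕ} (h : History S A n) :
    Measure (PathStep S A) :=
  if M.IsTerminal (History.last h) then Measure.dirac ⟨none, History.last h⟩
  else ∑ a, ∑ t, ENNReal.ofReal (σ.prob n h a * M.P (History.last h) a t) •
    Measure.dirac ⟨some a, t⟩

theorem Policy.stepMeasure_isProb (σ : M.Policy) {n : ℕ} (h : History S A n) :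
    IsProbabilityMeasure (σ.stepMeasure h) := by
  unfold Policy.stepMeasure
  split_ifs with ht
  · infer_instance
  · refine ⟨?_⟩
    have hnn : ∀ a t, 0 ≤ σ.prob n h a * M.P (History.last h) a t := fun a t =>
      mul_nonneg (σ.nonneg n h a) (M.P_nonneg _ _ _)
    simp only [Measure.finsetSum_apply, Measure.smul_apply, smul_eq_mul, measure_univ, mul_one]
    simp_rw [← ENNReal.ofReal_sum_of_nonneg fun t _ => hnn _ t]
    rw [← ENNReal.ofReal_sum_of_nonneg fun a _ => Finset.sum_nonneg fun t _ => hnn a t,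
      ← ENNReal.ofReal_one, ← σ.sum_one n h ht]
    congr 1
    refine Finset.sum_congr rfl fun a _ => ?_
    rw [← Finset.mul_sum]
    by_cases h0 : σ.prob n h a = 0
    · simp [h0]
    · have h1 : ∑ t, M.P (History.last h) a t = 1 := σ.enabled n h a h0
      rw [h1, mul_one]

/-- The transition kernels of the Markov chain (on finite paths) that a policy induces. -/
noncomputable def Policy.kernel (σ : M.Policy) (n : ℕ) :
    Kernel (History S A n) (PathStep S A) :=
  Kernel.ofFunOfCountable fun h => σ.stepMeasure h

instance (σ : M.Policy) (n : ℕ) : IsMarkovKernel (σ.kernel n) :=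
  ⟨fun h => σ.stepMeasure_isProb h⟩

/-- `Pr^σ_{M,s}`: the probability measure on the maximal paths from `s` under the policy `σ`. -/
noncomputable def Policy.pathMeasure (σ : M.Policy) (s : S) : Measure (ℕ → PathStep S A) :=
  Kernel.traj (X := fun _ => PathStep S A) σ.kernel 0 (fun _ => ⟨none, s⟩)

instance (σ : M.Policy) (s : S) : IsProbabilityMeasure (σ.pathMeasure s) := by
  unfold Policy.pathMeasure
  infer_instance

/-- The event `◇ T`: some state of `T` is visited. -/
def eventually (A : Type*) {S : Type*} (T : Set S) : Set (ℕ → PathStep S A) :=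
  {ω | ∃ n, (ω n).state ∈ T}

/-- `σ` is a global probability-raising policy for `C` and `E`. -/
def Policy.IsGPR (σ : M.Policy) (C E : Set S) : Prop :=
  0 < σ.pathMeasure M.init (eventually A C) ∧
  σ.pathMeasure M.init (eventually A E) <
    cond (σ.pathMeasure M.init) (eventually A C) (eventually A E)

variable (M)

/-- `Pr^min_{M,s}(◇ E)`. -/
noncomputable def minReach (E : Set S) (s : S) : ℝ :=
  ⨅ σ : M.Policy, (σ.pathMeasure s).real (eventually A E)

/-- `Pr^max_{M,s}(◇ E)`. -/
noncomputable def maxReach (E : Set S) (s : S) : ℝ :=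
  ⨆ σ : M.Policy, (σ.pathMeasure s).real (eventually A E)

/-! ### State-action frequencies -/

/-- The state-action pairs. -/
abbrev StAct : Type _ := {p : S × A // M.Enabled p.1 p.2}

/-- The terminal states. -/
abbrev Terminal : Type _ := {t : S // M.IsTerminal t}

noncomputable instance : Fintype M.StAct := Fintype.ofFinite _

variable {M}

open Classical in
/-- The frequency `x_s` of a state: the sum of the `x_{s,α}` over the enabled actions `α` if `s` is
not terminal, and the separate variable `y_s` if it is. -/
noncomputable def stateFreq (x : M.StAct → ℝ) (y : M.Terminal → ℝ) (s : S) : ℝ :=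
  if h : M.IsTerminal s then y ⟨s, h⟩ else ∑ p : M.StAct, if p.1.1 = s then x p else 0

/-- The linear constraints on state-action frequencies: nonnegativity and flow balance. -/
structure IsFreqSolution (x : M.StAct → ℝ) (y : M.Terminal → ℝ) : Prop where
  nonneg : ∀ p, 0 ≤ x p
  balance_init : stateFreq x y M.init = 1 + ∑ p : M.StAct, x p * M.P p.1.1 p.1.2 M.init
  balance : ∀ s, s ≠ M.init → stateFreq x y s = ∑ p : M.StAct, x p * M.P p.1.1 p.1.2 s

variable (M)

/-! ### End components and the quotient by maximal end components -/

/-- `(T, B)` is an end component: a strongly connected sub-MDP with states `T` and state-action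
pairs `B`, containing at least one state-action pair. -/
structure IsEC (T : Set S) (B : Set (S × A)) : Prop where
  nonempty : B.Nonempty
  mem : ∀ p ∈ B, p.1 ∈ T
  enabled : ∀ p ∈ B, M.Enabled p.1 p.2
  closed : ∀ p ∈ B, ∀ t, 0 < M.P p.1 p.2 t → t ∈ T
  conn : ∀ s ∈ T, ∀ t ∈ T,
    Relation.ReflTransGen (fun u v => ∃ a, (u, a) ∈ B ∧ 0 < M.P u a v) s t

/-- Maximal end components. -/
def IsMEC (T : Set S) (B : Set (S × A)) : Prop :=
  M.IsEC T B ∧ ∀ T' B', M.IsEC T' B' → T ⊆ T' → B ⊆ B' → T' = T ∧ B' = B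

variable {M}

theorem IsEC.union {T₁ T₂ : Set S} {B₁ B₂ : Set (S × A)} (h₁ : M.IsEC T₁ B₁)
    (h₂ : M.IsEC T₂ B₂) {u : S} (hu₁ : u ∈ T₁) (hu₂ : u ∈ T₂) :
    M.IsEC (T₁ ∪ T₂) (B₁ ∪ B₂) where
  nonempty := h₁.nonempty.inl
  mem p hp := hp.imp (h₁.mem p) (h₂.mem p)
  enabled p hp := hp.elim (h₁.enabled p) (h₂.enabled p)
  closed p hp t ht := hp.imp (fun hp => h₁.closed p hp t ht) (fun hp => h₂.closed p hp t ht)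
  conn := by
    have m₁ : ∀ s ∈ T₁, ∀ t ∈ T₁, Relation.ReflTransGen
        (fun u v => ∃ a, (u, a) ∈ B₁ ∪ B₂ ∧ 0 < M.P u a v) s t := fun s hs t ht =>
      Relation.ReflTransGen.mono (fun _ _ ⟨a, ha, hp⟩ => ⟨a, Or.inl ha, hp⟩) _ _ (h₁.conn s hs t ht)
    have m₂ : ∀ s ∈ T₂, ∀ t ∈ T₂, Relation.ReflTransGen
        (fun u v => ∃ a, (u, a) ∈ B₁ ∪ B₂ ∧ 0 < M.P u a v) s t := fun s hs t ht =>
      Relation.ReflTransGen.mono (fun _ _ ⟨a, ha, hp⟩ => ⟨a, Or.inr ha, hp⟩) _ _ (h₂.conn s hs t ht)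
    rintro s (hs | hs) t (ht | ht)
    · exact m₁ s hs t ht
    · exact (m₁ s hs u hu₁).trans (m₂ u hu₂ t ht)
    · exact (m₂ s hs u hu₂).trans (m₁ u hu₁ t ht)
    · exact m₂ s hs t ht

theorem IsMEC.eq {T₁ T₂ : Set S} {B₁ B₂ : Set (S × A)} (h₁ : M.IsMEC T₁ B₁)
    (h₂ : M.IsMEC T₂ B₂) {u : S} (hu₁ : u ∈ T₁) (hu₂ : u ∈ T₂) : T₁ = T₂ := by
  have hU := h₁.1.union h₂.1 hu₁ hu₂
  have e₁ := (h₁.2 _ _ hU Set.subset_union_left Set.subset_union_left).1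
  have e₂ := (h₂.2 _ _ hU Set.subset_union_right Set.subset_union_right).1
  exact e₁.symm.trans e₂

variable (M)

/-- States are identified if they lie in the same maximal end component. -/
def mecSetoid : Setoid S where
  r s t := s = t ∨ ∃ T B, M.IsMEC T B ∧ s ∈ T ∧ t ∈ T
  iseqv :=
    { refl := fun _ => Or.inl rfl
      symm := by
        rintro s t (h | ⟨T, B, h, hs, ht⟩)
        · exact Or.inl h.symm
        · exact Or.inr ⟨T, B, h, ht, hs⟩
      trans := by
        rintro s t u (rfl | ⟨T, B, h, hs, ht⟩) (rfl | ⟨T', B', h', ht', hu⟩)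
        · exact Or.inl rfl
        · exact Or.inr ⟨T', B', h', ht', hu⟩
        · exact Or.inr ⟨T, B, h, hs, ht⟩
        · have e := h.eq h' ht ht'
          exact Or.inr ⟨T, B, h, hs, e ▸ hu⟩ }

/-- The states of the quotient by maximal end components. -/
abbrev MecQuot : Type _ := Quotient M.mecSetoid

noncomputable instance : Fintype M.MecQuot := Fintype.ofFinite _

/-- The class of a state in the quotient. -/
def toQuot (s : S) : M.MecQuot := Quotient.mk M.mecSetoid s

/-- The pair `(s, a)` belongs to some maximal end component. -/
def InMEC (s : S) (a : A) : Prop := ∃ T B, M.IsMEC T B ∧ (s, a) ∈ B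

/-- The class `q` represents a maximal end component. -/
def IsMECClass (q : M.MecQuot) : Prop := ∃ T B, M.IsMEC T B ∧ ∃ s ∈ T, M.toQuot s = q

open Classical in
/-- The quotient of an MDP by its maximal end components. The actions of a class `q` are the pairs
`(s, a)` where `s` belongs to `q` and `a` is enabled in `s`, without the pairs inside maximal end
components. -/
noncomputable def mecQuotient : MDP M.MecQuot (S × A) where
  P q b q' := if M.toQuot b.1 = q ∧ ¬ M.InMEC b.1 b.2 then
    ∑ t, if M.toQuot t = q' then M.P b.1 b.2 t else 0 else 0
  init := M.toQuot M.init
  P_nonneg q b q' := by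
    split_ifs
    · refine Finset.sum_nonneg fun t _ => ?_
      split_ifs
      · exact M.P_nonneg _ _ _
      · exact le_rfl
    · exact le_rfl
  P_sum q b := by
    by_cases h : M.toQuot b.1 = q ∧ ¬ M.InMEC b.1 b.2
    · simp only [h, not_false_eq_true, and_self, if_true]
      rw [Finset.sum_comm]
      simpa using M.P_sum b.1 b.2
    · simp [h]

theorem minReach_mem (E : Set S) (s : S) : 0 ≤ M.minReach E s ∧ M.minReach E s ≤ 1 := by
  refine ⟨Real.iInf_nonneg fun σ => measureReal_nonneg, ?_⟩
  unfold minReach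
  rcases isEmpty_or_nonempty M.Policy with h | ⟨⟨σ⟩⟩
  · simp
  · exact (ciInf_le ⟨0, by rintro _ ⟨τ, rfl⟩; exact measureReal_nonneg⟩ σ).trans measureReal_le_one

theorem maxReach_mem (E : Set S) (s : S) : 0 ≤ M.maxReach E s ∧ M.maxReach E s ≤ 1 :=
  ⟨Real.iSup_nonneg fun _ => measureReal_nonneg,
    Real.iSup_le (fun _ => measureReal_le_one) zero_le_one⟩

end Basic

/-! ### The canonical MDP -/

/-- The two fresh terminal states of the first step. -/
inductive Verdict where
  | TP
  | FP

/-- The two fresh actions of the first step. -/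
inductive Choice where
  | min
  | max

/-- The four terminal states of the canonical MDP. -/
inductive Outcome where
  | TP
  | FP
  | FN
  | TN

instance : Fintype Verdict := ⟨⟨[Verdict.TP, Verdict.FP], by simp⟩, by rintro (_ | _) <;> simp⟩

instance : Fintype Choice := ⟨⟨[Choice.min, Choice.max], by simp⟩, by rintro (_ | _) <;> simp⟩

instance : Fintype Outcome :=
  ⟨⟨[Outcome.TP, Outcome.FP, Outcome.FN, Outcome.TN], by simp⟩, by rintro (_ | _ | _ | _) <;> simp⟩

section Canonical

variable {S A : Type*} [Fintype S] [Fintype A] (M : MDP S A) (C E : Set S)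

/-- The probability with which the action `min` or `max` of `c` moves to `TP`. -/
noncomputable def choiceProb (m : Choice) (c : S) : ℝ :=
  match m with
  | .min => M.minReach E c
  | .max => M.maxReach E c

open Classical in
/-- The transition probabilities after the first step. -/
noncomputable def minMaxP : S ⊕ Verdict → A ⊕ Choice → S ⊕ Verdict → ℝ
  | .inl s, .inl a, .inl t => if s ∈ C then 0 else M.P s a t
  | .inl s, .inr m, .inr .TP => if s ∈ C then M.choiceProb E m s else 0
  | .inl s, .inr m, .inr .FP => if s ∈ C then 1 - M.choiceProb E m s else 0
  | _, _, _ => 0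

theorem choiceProb_mem (m : Choice) (s : S) :
    0 ≤ M.choiceProb E m s ∧ M.choiceProb E m s ≤ 1 := by
  cases m
  · exact M.minReach_mem E s
  · exact M.maxReach_mem E s

/-- First step: the transitions of the states of `C` are replaced by the actions `min` and `max`,
which move to `TP` with the minimal and maximal probability of reaching `E`, else to `FP`. -/
noncomputable def minMax : MDP (S ⊕ Verdict) (A ⊕ Choice) where
  P := M.minMaxP C E
  init := .inl M.init
  P_nonneg := by
    rintro (s | v) (a | m) (t | _ | _) <;> simp only [minMaxP, le_refl]
    · split_ifs
      · exact le_rfl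
      · exact M.P_nonneg _ _ _
    · split_ifs
      · exact (M.choiceProb_mem E m s).1
      · exact le_rfl
    · split_ifs
      · linarith [(M.choiceProb_mem E m s).2]
      · exact le_rfl
  P_sum := by
    have hu : ∀ f : Verdict → ℝ, ∑ v, f v = f .TP + f .FP := fun f => by
      change (Multiset.map f ([Verdict.TP, Verdict.FP] : List Verdict)).sum = _
      simp
    rintro (s | v) (a | m)
    · by_cases h : s ∈ C
      · simp [minMaxP, hu, h]
      · simpa [minMaxP, hu, h] using M.P_sum s a
    · by_cases h : s ∈ C <;> simp [minMaxP, hu, h]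
    · simp [minMaxP]
    · simp [minMaxP]

/-- The states of the MDP after the second step, the quotient by maximal end components. -/
abbrev CanQuot : Type _ := (M.minMax C E).MecQuot

/-- The class consists of a state that is terminal before the quotient is taken. -/
def IsTerminalClass (q : M.CanQuot C E) : Prop :=
  ∃ s, (M.minMax C E).IsTerminal s ∧ (M.minMax C E).toQuot s = q

/-- The states of the canonical MDP: the non-terminal classes and the four terminal states. -/
abbrev CanState : Type _ := {q : M.CanQuot C E // ¬ M.IsTerminalClass C E q} ⊕ Outcome

noncomputable instance : Fintype (M.CanState C E) := Fintype.ofFinite _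

open Classical in
/-- The terminal states `TP` and `FP` are kept, the states of `E` become `FN`, and all other
terminal states become `TN`. -/
noncomputable def outcome (q : M.CanQuot C E) : Outcome :=
  if q = (M.minMax C E).toQuot (.inr .TP) then .TP
  else if q = (M.minMax C E).toQuot (.inr .FP) then .FP
  else if ∃ e ∈ E, q = (M.minMax C E).toQuot (.inl e) then .FN
  else .TN

open Classical in
/-- Third step: collapsing the terminal states into four. -/
noncomputable def collapse (q : M.CanQuot C E) : M.CanState C E :=
  if h : M.IsTerminalClass C E q then .inr (M.outcome C E q) else .inl ⟨q, h⟩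

open Classical in
/-- The transition probabilities of the canonical MDP. The action `none` is the fresh action `τ`
that moves from the classes of maximal end components to `TN`. -/
noncomputable def canonicalP :
    M.CanState C E → Option ((S ⊕ Verdict) × (A ⊕ Choice)) → M.CanState C E → ℝ
  | .inl q, some b, z =>
      ∑ q', if M.collapse C E q' = z then (M.minMax C E).mecQuotient.P q.1 b q' else 0
  | .inl q, none, z => if (M.minMax C E).IsMECClass q.1 ∧ z = .inr .TN then 1 else 0
  | .inr _, _, _ => 0

/-- The canonical MDP of `M` for `C` and `E`. -/
noncomputable def canonical : MDP (M.CanState C E) (Option ((S ⊕ Verdict) × (A ⊕ Choice))) where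
  P := M.canonicalP C E
  init := M.collapse C E (M.minMax C E).mecQuotient.init
  P_nonneg := by
    rintro (q | o) (_ | b) z <;> simp only [canonicalP, le_refl]
    · split_ifs <;> simp
    · refine Finset.sum_nonneg fun q' _ => ?_
      split_ifs
      · exact MDP.P_nonneg _ _ _ _
      · exact le_rfl
  P_sum := by
    classical
    rintro (q | o) (_ | b) <;> simp only [canonicalP, Finset.sum_const_zero, true_or]
    · by_cases h : (M.minMax C E).IsMECClass q.1 <;> simp [h]
    · rw [Finset.sum_comm]
      simpa using (M.minMax C E).mecQuotient.P_sum q.1 b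

/-- The states of `C` in the canonical MDP. -/
def canonicalC : Set (M.CanState C E) :=
  {z | ∃ c ∈ C, z = M.collapse C E ((M.minMax C E).toQuot (.inl c))}

/-- The target set `{TP, FN}` of the canonical MDP. -/
def canonicalE : Set (M.CanState C E) := {.inr .TP, .inr .FN}

end Canonical

end MDP

/-! The variables of the program are expected visit counts: `x` counts how often an action is chosen
in a state, and the frequency of a terminal state is the probability of reaching it. The theorem
combines a correspondence between solutions and policies, as far as terminal states are concerned,
with an identity between four numbers.

The correspondence rests on visit counts being finite. The canonical MDP has no end components
(`canonical_not_isEC`), so no choice of actions can avoid the terminal states forever, and there is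
a bounded function on states that drops by at least 1 in expectation with every action
(`exists_isPotential`). Summing these drops along a run bounds the expected number of visits, and
the counts of a policy therefore satisfy flow balance (`Policy.isFreqSolution`). Conversely,
normalising a solution in each state gives a memoryless policy. The solution and the counts of this
policy satisfy the same linear system. That system determines the frequencies of non-terminal
states, since a nonzero difference, weighted by the potential, would be strictly smaller than itself
(`eq_of_balanced`). Terminal frequencies are inflows and hence agree too
(`exists_policy_of_isFreqSolution`).

For the identity, `C` is left only to `TP` and `FP`, which are entered only from `C`; so `◇ C` is
almost surely `◇ {TP, FP}` (`ae_eventually_canonicalC`). If the four probabilities p add up to 1,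
the GPR inequality reads p_TP / (p_TP + p_FP) > p_TP + p_FN, and p_TP − (p_TP + p_FP)(p_TP + p_FN) =
p_TP p_TN − p_FP p_FN (`isGPR_canonical_iff`). -/

namespace MDP

open Filter Topology

/-! ### One-step behaviour of the path measure and occupation probabilities. -/

section PathMeasure

variable {S A : Type*} [Fintype S] [Fintype A] {M : MDP S A}

/-- The finite path that consists of the first `n` steps of a run. -/
abbrev runPrefix (n : ℕ) (ω : ℕ → PathStep S A) : History S A n :=
  Preorder.frestrictLe (π := fun _ => PathStep S A) n ω

omit [Fintype S] [Fintype A] in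
theorem runPrefix_last (n : ℕ) (ω : ℕ → PathStep S A) :
    History.last (runPrefix n ω) = (ω n).state := rfl

omit [Fintype S] [Fintype A] in
theorem measurable_runPrefix (n : ℕ) : Measurable (runPrefix (S := S) (A := A) n) :=
  Preorder.measurable_frestrictLe n

namespace Policy

variable (σ : M.Policy) (s₀ : S)

/-- The joint law of a prefix and the next step is the composition product of the prefix law with
the kernel. The one-step facts about runs below are derived from this form of the Markov property.
-/
theorem pathMeasure_next (n : ℕ) (B : History S A n → Set (PathStep S A)) :
    σ.pathMeasure s₀ {ω | ω (n + 1) ∈ B (runPrefix n ω)} =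
      ∫⁻ ω, σ.stepMeasure (runPrefix n ω) (B (runPrefix n ω)) ∂σ.pathMeasure s₀ := by
  have hB : MeasurableSet {p : History S A n × PathStep S A | p.2 ∈ B p.1} :=
    MeasurableSet.of_discrete
  have key := Kernel.partialTraj_compProd_eq_map_traj (X := fun _ => PathStep S A)
    (κ := σ.kernel) (Nat.zero_le n) (x₀ := fun _ => ⟨none, s₀⟩)
  have h1 := congrArg (fun μ => μ {p : History S A n × PathStep S A | p.2 ∈ B p.1}) key
  rw [Measure.map_apply (by fun_prop) hB, Measure.compProd_apply hB,
    ← Kernel.traj_map_frestrictLe_apply, lintegral_map Measurable.of_discrete (by fun_prop)] at h1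
  exact h1.symm

theorem ae_next (n : ℕ) (B : History S A n → Set (PathStep S A))
    (h : ∀ ω, σ.stepMeasure (runPrefix n ω) (B (runPrefix n ω))ᶜ = 0) :
    ∀ᵐ ω ∂σ.pathMeasure s₀, ω (n + 1) ∈ B (runPrefix n ω) := by
  have := σ.pathMeasure_next s₀ n (fun h => (B h)ᶜ)
  simp only [h, lintegral_zero] at this
  exact this

theorem stepMeasure_terminal {n : ℕ} {h : History S A n} (ht : M.IsTerminal h.last) :
    σ.stepMeasure h = Measure.dirac ⟨none, h.last⟩ := by
  rw [stepMeasure, if_pos ht]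

theorem stepMeasure_apply {n : ℕ} {h : History S A n} (ht : ¬ M.IsTerminal h.last)
    (B : Set (PathStep S A)) [DecidablePred (· ∈ B)] :
    σ.stepMeasure h B = ENNReal.ofReal
      (∑ a, ∑ t, if (⟨some a, t⟩ : PathStep S A) ∈ B then σ.prob n h a * M.P h.last a t else 0) := by
  have hnn : ∀ a t, 0 ≤ if (⟨some a, t⟩ : PathStep S A) ∈ B then
      σ.prob n h a * M.P h.last a t else 0 := fun a t => by
    split_ifs
    · exact mul_nonneg (σ.nonneg n h a) (M.P_nonneg _ _ _)
    · exact le_rfl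
  rw [stepMeasure, if_neg ht, ENNReal.ofReal_sum_of_nonneg fun a _ =>
    Finset.sum_nonneg fun t _ => hnn a t]
  simp only [Measure.finsetSum_apply, Measure.smul_apply, smul_eq_mul]
  refine Finset.sum_congr rfl fun a _ => ?_
  rw [ENNReal.ofReal_sum_of_nonneg fun t _ => hnn a t]
  refine Finset.sum_congr rfl fun t _ => ?_
  by_cases hB : (⟨some a, t⟩ : PathStep S A) ∈ B <;> simp [hB]

theorem ae_init : ∀ᵐ ω ∂σ.pathMeasure s₀, (ω 0).state = s₀ := by
  have h := Kernel.traj_map_frestrictLe_apply (X := fun _ => PathStep S A)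
    (κ := σ.kernel) 0 0 (fun _ => ⟨none, s₀⟩)
  rw [Kernel.partialTraj_self, Kernel.id_apply] at h
  have h2 : ∀ᵐ x ∂(σ.pathMeasure s₀).map (runPrefix 0), x = fun _ => ⟨none, s₀⟩ := by
    rw [pathMeasure, h, ae_dirac_eq]
    rfl
  filter_upwards [ae_of_ae_map (measurable_runPrefix 0).aemeasurable h2] with ω hω
  rw [← runPrefix_last, hω]
  rfl

/-- Almost every run stays in a terminal state and otherwise follows the transitions of enabled
actions. -/
theorem ae_transition : ∀ᵐ ω ∂σ.pathMeasure s₀, ∀ n,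
    (M.IsTerminal (ω n).state ∧ (ω (n + 1)).state = (ω n).state) ∨
    (¬ M.IsTerminal (ω n).state ∧
      ∃ a, M.Enabled (ω n).state a ∧ 0 < M.P (ω n).state a (ω (n + 1)).state) := by
  classical
  rw [ae_all_iff]
  intro n
  refine σ.ae_next s₀ n (fun h => {y | (M.IsTerminal h.last ∧ y.state = h.last) ∨
    (¬ M.IsTerminal h.last ∧ ∃ a, M.Enabled h.last a ∧ 0 < M.P h.last a y.state)}) fun ω => ?_
  generalize runPrefix n ω = h
  by_cases ht : M.IsTerminal h.last
  · rw [σ.stepMeasure_terminal ht, Measure.dirac_apply]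
    simp [ht]
  · rw [σ.stepMeasure_apply ht, ENNReal.ofReal_eq_zero]
    refine (Finset.sum_eq_zero fun a _ => Finset.sum_eq_zero fun t _ => ?_).le
    split_ifs with hc
    · simp only [ht, false_and, not_false_eq_true, true_and, false_or, Set.mem_compl_iff,
        Set.mem_ofPred_eq, not_exists, not_and, not_lt] at hc
      by_cases h0 : σ.prob n h a = 0
      · simp [h0]
      · rw [le_antisymm (hc a (σ.enabled n h a h0)) (M.P_nonneg _ _ _), mul_zero]
    · rfl

/-- The probability of being in `s` at time `n`. -/
noncomputable def occ (n : ℕ) (s : S) : ℝ := (σ.pathMeasure s₀).real {ω | (ω n).state = s}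

open Classical in
/-- The probability of being in `s` and choosing `a` at time `n`. -/
noncomputable def freq (n : ℕ) (s : S) (a : A) : ℝ :=
  ∫ ω, if (ω n).state = s then σ.prob n (runPrefix n ω) a else 0 ∂σ.pathMeasure s₀

/-- There are only finitely many prefixes of a given length, so every function of them is
integrable. -/
theorem integrable_runPrefix (n : ℕ) (g : History S A n → ℝ) :
    Integrable (fun ω => g (runPrefix n ω)) (σ.pathMeasure s₀) := by
  have : Integrable g ((σ.pathMeasure s₀).map (runPrefix n)) := by
    have : IsFiniteMeasure ((σ.pathMeasure s₀).map (runPrefix n)) := by infer_instance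
    exact Integrable.of_finite
  exact this.comp_measurable (measurable_runPrefix n)

theorem occ_nonneg (n : ℕ) (s : S) : 0 ≤ σ.occ s₀ n s := measureReal_nonneg

omit [Fintype S] [Fintype A] in
theorem measurable_state (n : ℕ) : Measurable fun ω : ℕ → PathStep S A => ω n :=
  measurable_pi_apply n

omit [Fintype S] [Fintype A] in
theorem measurableSet_state (n : ℕ) (s : S) :
    MeasurableSet {ω : ℕ → PathStep S A | (ω n).state = s} :=
  measurable_state n (MeasurableSet.of_discrete (s := {y : PathStep S A | y.state = s}))

theorem freq_nonneg (n : ℕ) (s : S) (a : A) : 0 ≤ σ.freq s₀ n s a :=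
  integral_nonneg fun ω => by
    dsimp only
    split_ifs
    · exact σ.nonneg _ _ _
    · exact le_rfl

theorem freq_eq_zero {n : ℕ} {s : S} {a : A} (h : ¬ M.Enabled s a) : σ.freq s₀ n s a = 0 := by
  refine integral_eq_zero_of_ae (ae_of_all _ fun ω => ?_)
  dsimp only [Pi.zero_apply]
  split_ifs with hs
  · by_contra h0
    have := σ.enabled _ _ _ h0
    rw [runPrefix_last, hs] at this
    exact h this
  · rfl

open Classical in
theorem occ_eq_integral (n : ℕ) (s : S) :
    σ.occ s₀ n s = ∫ ω, if (ω n).state = s then 1 else 0 ∂σ.pathMeasure s₀ := by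
  rw [occ, ← integral_indicator_one (measurableSet_state n s)]
  congr 1 with ω

theorem sum_freq {n : ℕ} {s : S} (h : ¬ M.IsTerminal s) :
    ∑ a, σ.freq s₀ n s a = σ.occ s₀ n s := by
  classical
  rw [occ_eq_integral]
  unfold freq
  have hi : ∀ a, Integrable (fun ω : ℕ → PathStep S A =>
      if (ω n).state = s then σ.prob n (runPrefix n ω) a else 0) (σ.pathMeasure s₀) := fun a =>
    σ.integrable_runPrefix s₀ n (fun h => if h.last = s then σ.prob n h a else 0)
  rw [← integral_finsetSum _ fun a _ => hi a]
  congr 1 with ω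
  split_ifs with hs
  · exact σ.sum_one _ _ (by rwa [runPrefix_last, hs])
  · simp

open Classical in
theorem occ_zero (s : S) : σ.occ s₀ 0 s = if s = s₀ then 1 else 0 := by
  rw [occ]
  split_ifs with h
  · rw [measureReal_def, mem_ae_iff_prob_eq_one (measurableSet_state 0 s) |>.1,
      ENNReal.toReal_one]
    filter_upwards [σ.ae_init s₀] with ω hω using by simp [hω, h]
  · rw [measureReal_def, (measure_eq_zero_iff_ae_notMem).2, ENNReal.toReal_zero]
    filter_upwards [σ.ae_init s₀] with ω hω
    simp only [hω]
    exact fun e => h e.symm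

/-- The probability of moving from a state that is not terminal to `t` at time `n + 1`. -/
noncomputable def inflow (n : ℕ) (t : S) : ℝ := ∑ s, ∑ a, σ.freq s₀ n s a * M.P s a t

-- The extra term for terminal states comes from the encoding: a stopped run repeats its last state
-- forever, so the mass that has already arrived stays.
open Classical in
theorem occ_succ (n : ℕ) (t : S) :
    σ.occ s₀ (n + 1) t = σ.inflow s₀ n t + if M.IsTerminal t then σ.occ s₀ n t else 0 := by
  have h1 : σ.occ s₀ (n + 1) t =
      ∫ ω, (σ.stepMeasure (runPrefix n ω)).real {y | y.state = t} ∂σ.pathMeasure s₀ := by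
    rw [occ, measureReal_def]
    have h := σ.pathMeasure_next s₀ n (fun _ => {y | y.state = t})
    simp only [Set.mem_ofPred_eq] at h
    rw [h]
    simp only [measureReal_def]
    rw [integral_toReal]
    · exact (Measurable.of_discrete (f := fun h : History S A n =>
        σ.stepMeasure h {y | y.state = t})).comp (measurable_runPrefix n) |>.aemeasurable
    · refine ae_of_all _ fun ω => ?_
      have := σ.stepMeasure_isProb (runPrefix n ω)
      exact measure_lt_top _ _
  have h2 : ∀ ω : ℕ → PathStep S A, (σ.stepMeasure (runPrefix n ω)).real {y | y.state = t} =
      (∑ s, ∑ a, (if (ω n).state = s then σ.prob n (runPrefix n ω) a else 0) * M.P s a t) +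
      if M.IsTerminal t then if (ω n).state = t then 1 else 0 else 0 := by
    intro ω
    rw [Finset.sum_comm]
    simp only [ite_mul, zero_mul, Finset.sum_ite_eq, Finset.mem_univ, if_true]
    rw [← runPrefix_last]
    generalize runPrefix n ω = h
    by_cases ht : M.IsTerminal h.last
    · have hz : ∀ a, σ.prob n h a = 0 := fun a => by
        by_contra h0
        exact ht a (σ.enabled _ _ _ h0)
      rw [σ.stepMeasure_terminal ht, measureReal_def, Measure.dirac_apply]
      by_cases e : h.last = t
      · subst e
        simp [hz, ht]
      · simp [hz, e]
    · rw [measureReal_def, σ.stepMeasure_apply ht, ENNReal.toReal_ofReal]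
      · have : (if M.IsTerminal t then if h.last = t then (1 : ℝ) else 0 else 0) = 0 := by
          split_ifs with a b
          · exact absurd (b ▸ a) ht
          · rfl
          · rfl
        rw [this, add_zero]
        simp
      · refine Finset.sum_nonneg fun a _ => Finset.sum_nonneg fun t _ => ?_
        split_ifs
        · exact mul_nonneg (σ.nonneg n h a) (M.P_nonneg _ _ _)
        · exact le_rfl
  rw [h1]
  simp_rw [h2]
  have hi : ∀ s a, Integrable (fun ω : ℕ → PathStep S A =>
      (if (ω n).state = s then σ.prob n (runPrefix n ω) a else 0) * M.P s a t)
      (σ.pathMeasure s₀) := fun s a =>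
    σ.integrable_runPrefix s₀ n
      (fun h => (if h.last = s then σ.prob n h a else 0) * M.P s a t)
  rw [integral_add, integral_finsetSum]
  · congr 1
    · rw [inflow]
      refine Finset.sum_congr rfl fun s _ => ?_
      rw [integral_finsetSum _ fun a _ => hi s a]
      refine Finset.sum_congr rfl fun a _ => ?_
      rw [integral_mul_const, freq]
    · split_ifs
      · rw [occ_eq_integral]
      · simp
  · exact fun s _ => integrable_finsetSum _ fun a _ => hi s a
  · exact integrable_finsetSum _ fun s _ => integrable_finsetSum _ fun a _ => hi s a
  · exact σ.integrable_runPrefix s₀ n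
      (fun h => if M.IsTerminal t then if h.last = t then 1 else 0 else 0)

/-- A run that satisfies the transition property remains in a terminal state. -/
theorem state_eq_of_terminal {ω : ℕ → PathStep S A}
    (hω : ∀ n, (M.IsTerminal (ω n).state ∧ (ω (n + 1)).state = (ω n).state) ∨
      (¬ M.IsTerminal (ω n).state ∧
        ∃ a, M.Enabled (ω n).state a ∧ 0 < M.P (ω n).state a (ω (n + 1)).state))
    {n k : ℕ} (hnk : n ≤ k) (h : M.IsTerminal (ω n).state) : (ω k).state = (ω n).state := by
  induction k, hnk using Nat.le_induction with
  | base => rfl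
  | succ k _ ih =>
    rcases hω k with ⟨_, e⟩ | ⟨e, _⟩
    · rw [e, ih]
    · exact absurd (ih ▸ h) e

/-- A terminal state is absorbing: up to null sets, having visited it by time `n` is the same as
being in it at time `n`. Continuity from below then gives the limit. -/
theorem tendsto_occ {t : S} (ht : M.IsTerminal t) :
    Tendsto (fun n => σ.occ s₀ n t) atTop (𝓝 ((σ.pathMeasure s₀).real (eventually A {t}))) := by
  have h := tendsto_measure_iUnion_accumulate (μ := σ.pathMeasure s₀)
    (f := fun n => {ω : ℕ → PathStep S A | (ω n).state = t})
  have h' := (ENNReal.tendsto_toReal (measure_ne_top _ _)).comp h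
  have e : eventually A {t} = ⋃ n, {ω : ℕ → PathStep S A | (ω n).state = t} := by
    ext ω
    simp [eventually]
  rw [measureReal_def, e]
  refine h'.congr fun n => ?_
  rw [occ, measureReal_def, Function.comp]
  congr 1
  refine measure_congr ?_
  filter_upwards [σ.ae_transition s₀] with ω hω
  refine propext ⟨fun hm => ?_, fun hm => ?_⟩
  · obtain ⟨k, hk, hkt⟩ := Set.mem_accumulate.1 hm
    have hkt : (ω k).state = t := hkt
    exact (state_eq_of_terminal hω hk (hkt ▸ ht)).trans hkt
  · exact Set.mem_accumulate.2 ⟨n, le_rfl, hm⟩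

end Policy

end PathMeasure

/-! ### Flow balance equations and their realisation by policies. -/

section Frequencies

variable {S A : Type*} [Fintype S] [Fintype A] {M : MDP S A}

theorem sum_stAct {f : S → A → ℝ} (hf : ∀ s a, ¬ M.Enabled s a → f s a = 0) :
    ∑ p : M.StAct, f p.1.1 p.1.2 = ∑ s, ∑ a, f s a := by
  classical
  rw [← Fintype.sum_prod_type', ← Finset.sum_subtype
    (Finset.univ.filter fun p : S × A => M.Enabled p.1 p.2) (by simp) (fun p => f p.1 p.2),
    Finset.sum_filter]
  refine Finset.sum_congr rfl fun p _ => ?_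
  split_ifs with h
  · rfl
  · exact (hf _ _ h).symm

open Classical in
theorem sum_stAct_fiber {f : S → A → ℝ} (hf : ∀ s a, ¬ M.Enabled s a → f s a = 0) (s : S) :
    (∑ p : M.StAct, if p.1.1 = s then f p.1.1 p.1.2 else 0) = ∑ a, f s a := by
  rw [sum_stAct (f := fun t a => if t = s then f t a else 0)]
  · rw [Finset.sum_comm]
    simp
  · intro t a h
    rw [hf t a h, ite_self]

open Classical in
theorem IsFreqSolution.stateFreq_eq {x : M.StAct → ℝ} {y : M.Terminal → ℝ}
    (h : IsFreqSolution x y) (s : S) :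
    stateFreq x y s = (if s = M.init then 1 else 0) + ∑ p : M.StAct, x p * M.P p.1.1 p.1.2 s := by
  split_ifs with hs
  · rw [hs, h.balance_init]
  · rw [h.balance s hs, zero_add]

theorem stateFreq_terminal (x : M.StAct → ℝ) (y : M.Terminal → ℝ) (t : M.Terminal) :
    stateFreq x y t = y t := by
  rw [stateFreq, dif_pos t.2]

theorem IsFreqSolution.stateFreq_nonneg {x : M.StAct → ℝ} {y : M.Terminal → ℝ}
    (h : IsFreqSolution x y) (s : S) : 0 ≤ stateFreq x y s := by
  rw [h.stateFreq_eq]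
  refine add_nonneg (by split_ifs <;> simp) (Finset.sum_nonneg fun p _ => ?_)
  exact mul_nonneg (h.nonneg p) (M.P_nonneg _ _ _)

/-- The frequencies of the terminal states add up to `1`. -/
theorem IsFreqSolution.sum_terminal {x : M.StAct → ℝ} {y : M.Terminal → ℝ}
    (h : IsFreqSolution x y) [Fintype M.Terminal] : ∑ t, y t = 1 := by
  classical
  -- Balance is summed over all states. Enabled actions have total mass 1, so the inflow adds up to
  -- `1 + ∑ x`; the left side is `∑ y + ∑ x`, and `∑ x` cancels.
  have h1 : ∑ s, stateFreq x y s = 1 + ∑ p : M.StAct, x p := by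
    simp_rw [h.stateFreq_eq]
    rw [Finset.sum_add_distrib, Finset.sum_comm]
    simp only [Finset.sum_ite_eq', Finset.mem_univ, if_true, ← Finset.mul_sum]
    congr 1
    refine Finset.sum_congr rfl fun p _ => ?_
    rw [show ∑ t, M.P p.1.1 p.1.2 t = 1 from p.2, mul_one]
  have h2 : ∑ s, stateFreq x y s =
      ∑ t, y t + ∑ s, ∑ p : M.StAct, if p.1.1 = s then x p else 0 := by
    have e : ∑ t, y t = ∑ s, if M.IsTerminal s then stateFreq x y s else 0 := by
      rw [← Finset.sum_filter, Finset.sum_subtype (p := M.IsTerminal) _ (by simp)]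
      exact Finset.sum_congr rfl fun t _ => (stateFreq_terminal x y t).symm
    rw [e, ← Finset.sum_add_distrib]
    refine Finset.sum_congr rfl fun s _ => ?_
    split_ifs with hs
    · rw [Finset.sum_eq_zero, add_zero]
      rintro p -
      rw [if_neg]
      rintro rfl
      exact hs _ p.2
    · rw [stateFreq, dif_neg hs, zero_add]
  rw [Finset.sum_comm] at h2
  simp only [Finset.sum_ite_eq, Finset.mem_univ, if_true] at h2
  linarith

variable (M) in
/-- A function that decreases by at least `1` in expectation with every action. -/
structure IsPotential (w : S → ℝ) : Prop where
  nonneg : ∀ s, 0 ≤ w s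
  decrease : ∀ s a, M.Enabled s a → 1 + ∑ t, M.P s a t * w t ≤ w s

namespace Policy

variable (σ : M.Policy) (s₀ : S)

open Classical in
theorem sum_freq_mul (n : ℕ) (g : S → ℝ) :
    ∑ s, ∑ a, σ.freq s₀ n s a * g s =
      ∑ s, if M.IsTerminal s then 0 else σ.occ s₀ n s * g s := by
  refine Finset.sum_congr rfl fun s _ => ?_
  rw [← Finset.sum_mul]
  split_ifs with hs
  · rw [Finset.sum_eq_zero fun a _ => σ.freq_eq_zero s₀ (hs a), zero_mul]
  · rw [σ.sum_freq s₀ hs]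

-- A drift inequality: each action taken at time `n` lowers the expected potential by at least 1,
-- and the mass that takes an action is the non-terminal occupation. Mass that enters a terminal
-- state is dropped, which only helps since the potential is nonnegative.
open Classical in
theorem sum_occ_mul_succ_le {w : S → ℝ} (hw : M.IsPotential w) (n : ℕ) :
    (∑ s, if M.IsTerminal s then 0 else σ.occ s₀ (n + 1) s * w s) +
      (∑ s, if M.IsTerminal s then 0 else σ.occ s₀ n s) ≤
    ∑ s, if M.IsTerminal s then 0 else σ.occ s₀ n s * w s := by
  have h1 : (∑ s, if M.IsTerminal s then 0 else σ.occ s₀ (n + 1) s * w s) ≤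
      ∑ s, ∑ a, σ.freq s₀ n s a * ∑ t, M.P s a t * w t := by
    calc _ ≤ ∑ t, σ.inflow s₀ n t * w t := by
          refine Finset.sum_le_sum fun t _ => ?_
          split_ifs with ht
          · refine mul_nonneg (Finset.sum_nonneg fun s _ => Finset.sum_nonneg fun a _ => ?_)
              (hw.nonneg t)
            exact mul_nonneg (σ.freq_nonneg _ _ _ _) (M.P_nonneg _ _ _)
          · rw [σ.occ_succ, if_neg ht, add_zero]
      _ = _ := by
          simp only [inflow, Finset.sum_mul, Finset.mul_sum, mul_assoc]
          rw [Finset.sum_comm]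
          refine Finset.sum_congr rfl fun s _ => ?_
          rw [Finset.sum_comm]
  have h2 : ∑ s, ∑ a, σ.freq s₀ n s a * ∑ t, M.P s a t * w t ≤
      ∑ s, ∑ a, σ.freq s₀ n s a * (w s - 1) := by
    refine Finset.sum_le_sum fun s _ => Finset.sum_le_sum fun a _ => ?_
    by_cases ha : M.Enabled s a
    · exact mul_le_mul_of_nonneg_left (by linarith [hw.decrease s a ha]) (σ.freq_nonneg _ _ _ _)
    · simp [σ.freq_eq_zero s₀ ha]
  rw [σ.sum_freq_mul s₀ n (fun s => w s - 1)] at h2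
  have h3 : (∑ s, if M.IsTerminal s then 0 else σ.occ s₀ n s * (w s - 1)) +
      (∑ s, if M.IsTerminal s then 0 else σ.occ s₀ n s) =
      ∑ s, if M.IsTerminal s then 0 else σ.occ s₀ n s * w s := by
    rw [← Finset.sum_add_distrib]
    refine Finset.sum_congr rfl fun s _ => ?_
    split_ifs
    · simp
    · ring
  linarith

/-- The drift inequality telescopes, so the initial expected potential bounds the total non-terminal
occupation. -/
theorem summable_occ {w : S → ℝ} (hw : M.IsPotential w) {s : S} (hs : ¬ M.IsTerminal s) :
    Summable fun n => σ.occ s₀ n s := by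
  classical
  set u : ℕ → ℝ := fun n => ∑ s, if M.IsTerminal s then 0 else σ.occ s₀ n s * w s with hu
  have hu0 : ∀ n, 0 ≤ u n := fun n => Finset.sum_nonneg fun s _ => by
    split_ifs
    · exact le_rfl
    · exact mul_nonneg (σ.occ_nonneg _ _ _) (hw.nonneg s)
  have hle : ∀ n, σ.occ s₀ n s ≤ ∑ s, if M.IsTerminal s then 0 else σ.occ s₀ n s := fun n => by
    have := Finset.single_le_sum (f := fun s => if M.IsTerminal s then 0 else σ.occ s₀ n s)
      (fun s _ => by
        split_ifs
        · exact le_rfl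
        · exact σ.occ_nonneg _ _ _) (Finset.mem_univ s)
    simpa [hs] using this
  refine summable_of_sum_range_le (c := u 0) (fun n => σ.occ_nonneg _ _ _) fun N => ?_
  have : ∀ N, ∑ n ∈ Finset.range N, σ.occ s₀ n s + u N ≤ u 0 := by
    intro N
    induction N with
    | zero => simp
    | succ N ih =>
      rw [Finset.sum_range_succ]
      linarith [σ.sum_occ_mul_succ_le s₀ hw N, hle N]
  linarith [this N, hu0 N]

theorem summable_freq {w : S → ℝ} (hw : M.IsPotential w) (s : S) (a : A) :
    Summable fun n => σ.freq s₀ n s a := by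
  by_cases h : M.Enabled s a
  · refine Summable.of_nonneg_of_le (fun n => σ.freq_nonneg _ _ _ _) (fun n => ?_)
      (σ.summable_occ s₀ hw (s := s) fun ht => ht a h)
    rw [← σ.sum_freq s₀ fun ht => ht a h]
    exact Finset.single_le_sum (fun a _ => σ.freq_nonneg s₀ n s a) (Finset.mem_univ a)
  · simp only [σ.freq_eq_zero s₀ h]
    exact summable_zero

/-- The expected number of times that `a` is chosen in `s`. -/
noncomputable def totalFreq (s : S) (a : A) : ℝ := ∑' n, σ.freq s₀ n s a

theorem totalFreq_eq_zero {s : S} {a : A} (h : ¬ M.Enabled s a) : σ.totalFreq s₀ s a = 0 := by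
  simp [totalFreq, σ.freq_eq_zero s₀ h]

theorem hasSum_inflow {w : S → ℝ} (hw : M.IsPotential w) (t : S) :
    HasSum (fun n => σ.inflow s₀ n t) (∑ s, ∑ a, σ.totalFreq s₀ s a * M.P s a t) :=
  hasSum_sum fun s _ => hasSum_sum fun a _ => (σ.summable_freq s₀ hw s a).hasSum.mul_right _

theorem hasSum_occ {w : S → ℝ} (hw : M.IsPotential w) {s : S} (hs : ¬ M.IsTerminal s) :
    HasSum (fun n => σ.occ s₀ n s) (∑ a, σ.totalFreq s₀ s a) := by
  simp_rw [← σ.sum_freq s₀ hs]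
  exact hasSum_sum fun a _ => (σ.summable_freq s₀ hw s a).hasSum

open Classical in
/-- The expected frequencies satisfy the flow balance equations, and the frequency of a terminal
state is the probability of reaching it. -/
theorem isFreqSolution {w : S → ℝ} (hw : M.IsPotential w) :
    IsFreqSolution (fun p : M.StAct => σ.totalFreq M.init p.1.1 p.1.2)
      (fun t => (σ.pathMeasure M.init).real (eventually A {t.1})) := by
  set x : M.StAct → ℝ := fun p => σ.totalFreq M.init p.1.1 p.1.2 with hx
  set y : M.Terminal → ℝ := fun t => (σ.pathMeasure M.init).real (eventually A {t.1}) with hy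
  have hin : ∀ s, ∑ p : M.StAct, x p * M.P p.1.1 p.1.2 s =
      ∑ t, ∑ a, σ.totalFreq M.init t a * M.P t a s := fun s =>
    sum_stAct (f := fun t a => σ.totalFreq M.init t a * M.P t a s) fun t a h => by
      rw [σ.totalFreq_eq_zero _ h, zero_mul]
  have key : ∀ s, stateFreq x y s =
      (if s = M.init then 1 else 0) + ∑ p : M.StAct, x p * M.P p.1.1 p.1.2 s := by
    intro s
    rw [hin]
    have hI := σ.hasSum_inflow M.init hw s
    by_cases hs : M.IsTerminal s
    · rw [stateFreq, dif_pos hs]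
      refine tendsto_nhds_unique (σ.tendsto_occ M.init hs) ?_
      -- By absorption, occupation at time `n` is the initial mass plus all inflow before `n`; both
      -- sides are limits of the same sequence.
      refine (hI.tendsto_sum_nat.const_add (if s = M.init then (1 : ℝ) else 0)).congr fun n => ?_
      induction n with
      | zero => simp [σ.occ_zero]
      | succ n ih => rw [Finset.sum_range_succ, σ.occ_succ, if_pos hs, ← ih]; ring
    · rw [stateFreq, dif_neg hs]
      rw [sum_stAct_fiber (f := fun t a => σ.totalFreq M.init t a)
        fun t a h => σ.totalFreq_eq_zero _ h]
      refine (σ.hasSum_occ M.init hw hs).unique ?_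
      rw [← σ.occ_zero M.init s]
      -- A non-terminal state retains no mass: its occupation at time `n + 1` is the inflow at `n`,
      -- and time 0 supplies the initial 1.
      refine HasSum.zero_add (f := fun n => σ.occ M.init n s) ?_
      simpa [σ.occ_succ, hs] using hI
  exact ⟨fun p => tsum_nonneg fun n => σ.freq_nonneg _ _ _ _, by simpa using key M.init,
    fun s hs => by simpa [hs] using key s⟩

end Policy

/-- The policy that chooses actions with probabilities that depend on the current state only. -/
noncomputable def stationary (π : S → A → ℝ) (h0 : ∀ s a, 0 ≤ π s a)
    (h1 : ∀ s a, π s a ≠ 0 → M.Enabled s a) (h2 : ∀ s, ¬ M.IsTerminal s → ∑ a, π s a = 1) :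
    M.Policy where
  prob _ h a := π h.last a
  nonneg _ _ _ := h0 _ _
  enabled _ _ _ := h1 _ _
  sum_one _ _ := h2 _

theorem stationary_totalFreq {π : S → A → ℝ} {h0 : ∀ s a, 0 ≤ π s a}
    {h1 : ∀ s a, π s a ≠ 0 → M.Enabled s a} {h2 : ∀ s, ¬ M.IsTerminal s → ∑ a, π s a = 1}
    (s₀ s : S) (a : A) :
    (stationary π h0 h1 h2).totalFreq s₀ s a = (∑' n, (stationary π h0 h1 h2).occ s₀ n s) * π s a := by
  classical
  rw [Policy.totalFreq, ← tsum_mul_right]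
  congr 1 with n
  rw [Policy.occ_eq_integral, ← integral_mul_const, Policy.freq]
  congr 1 with ω
  rw [ite_mul, one_mul, zero_mul]
  split_ifs with h
  · simp only [stationary]
    rw [runPrefix_last, h]
  · rfl

/-- Two state frequencies that are balanced for the same stationary policy agree. -/
theorem eq_of_balanced {w : S → ℝ} (hw : M.IsPotential w) {π : S → A → ℝ}
    (h0 : ∀ s a, 0 ≤ π s a) (h1 : ∀ s a, π s a ≠ 0 → M.Enabled s a)
    (h2 : ∀ s, ¬ M.IsTerminal s → ∑ a, π s a = 1) {b X X' : S → ℝ}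
    (hX : ∀ s, ¬ M.IsTerminal s → X s = b s + ∑ t, ∑ a, X t * π t a * M.P t a s)
    (hX' : ∀ s, ¬ M.IsTerminal s → X' s = b s + ∑ t, ∑ a, X' t * π t a * M.P t a s)
    {s : S} (hs : ¬ M.IsTerminal s) : X s = X' s := by
  classical
  -- Balance is assumed at non-terminal states only, so the difference is cut off at terminal ones.
  -- No information is lost, because `π` vanishes there.
  set d : S → ℝ := fun s => if M.IsTerminal s then 0 else |X s - X' s| with hd
  have hd0 : ∀ s, 0 ≤ d s := fun s => by
    simp only [hd]
    split_ifs
    · exact le_rfl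
    · exact abs_nonneg _
  have hstep : ∀ s, d s ≤ ∑ t, ∑ a, d t * π t a * M.P t a s := by
    intro s
    have hnn : ∀ t a, 0 ≤ d t * π t a * M.P t a s := fun t a =>
      mul_nonneg (mul_nonneg (hd0 t) (h0 t a)) (M.P_nonneg _ _ _)
    by_cases hs : M.IsTerminal s
    · simp only [hd, hs, if_true]
      exact Finset.sum_nonneg fun t _ => Finset.sum_nonneg fun a _ => hnn t a
    · have e : X s - X' s = ∑ t, ∑ a, (X t - X' t) * π t a * M.P t a s := by
        rw [hX s hs, hX' s hs, add_sub_add_left_eq_sub, ← Finset.sum_sub_distrib]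
        refine Finset.sum_congr rfl fun t _ => ?_
        rw [← Finset.sum_sub_distrib]
        exact Finset.sum_congr rfl fun a _ => by ring
      rw [show d s = |X s - X' s| by simp [hd, hs], e]
      refine (Finset.abs_sum_le_sum_abs _ _).trans (Finset.sum_le_sum fun t _ => ?_)
      refine (Finset.abs_sum_le_sum_abs _ _).trans (Finset.sum_le_sum fun a _ => ?_)
      rw [abs_mul, abs_mul, abs_of_nonneg (h0 t a), abs_of_nonneg (M.P_nonneg t a s)]
      by_cases ht : M.IsTerminal t
      · have : π t a = 0 := by
          by_contra h
          exact ht a (h1 t a h)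
        simp [this]
      · simp [hd, ht]
  -- One step of the chain costs a full unit of potential, so this bound forces the total of `d` to
  -- be at most 0.
  have h3 : ∑ s, d s * w s ≤ ∑ t, d t * (w t - 1) := by
    calc ∑ s, d s * w s ≤ ∑ s, (∑ t, ∑ a, d t * π t a * M.P t a s) * w s :=
          Finset.sum_le_sum fun s _ => mul_le_mul_of_nonneg_right (hstep s) (hw.nonneg s)
      _ = ∑ t, ∑ a, d t * π t a * ∑ s, M.P t a s * w s := by
          simp only [Finset.sum_mul, Finset.mul_sum, mul_assoc]
          rw [Finset.sum_comm]
          refine Finset.sum_congr rfl fun t _ => ?_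
          rw [Finset.sum_comm]
      _ ≤ ∑ t, ∑ a, d t * π t a * (w t - 1) := by
          refine Finset.sum_le_sum fun t _ => Finset.sum_le_sum fun a _ => ?_
          by_cases h : π t a = 0
          · simp [h]
          · exact mul_le_mul_of_nonneg_left (by linarith [hw.decrease t a (h1 t a h)])
              (mul_nonneg (hd0 t) (h0 t a))
      _ = ∑ t, d t * (w t - 1) := by
          refine Finset.sum_congr rfl fun t _ => ?_
          by_cases ht : M.IsTerminal t
          · simp [hd, ht]
          · rw [← Finset.sum_mul, ← Finset.mul_sum, h2 t ht, mul_one]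
  have h4 : ∑ t, d t ≤ 0 := by
    have : ∑ t, d t * (w t - 1) = ∑ t, d t * w t - ∑ t, d t := by
      rw [← Finset.sum_sub_distrib]
      exact Finset.sum_congr rfl fun t _ => by ring
    linarith
  have h5 : d s = 0 := by
    refine le_antisymm (le_trans ?_ h4) (hd0 s)
    exact Finset.single_le_sum (fun s _ => hd0 s) (Finset.mem_univ s)
  simp only [hd, hs, if_false, abs_eq_zero] at h5
  linarith

/-- The action probabilities that are proportional to given frequencies. -/
theorem exists_stationary_probabilities {x : M.StAct → ℝ} {y : M.Terminal → ℝ}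
    (h : IsFreqSolution x y) :
    ∃ π : S → A → ℝ, (∀ s a, 0 ≤ π s a) ∧ (∀ s a, π s a ≠ 0 → M.Enabled s a) ∧
      (∀ s, ¬ M.IsTerminal s → ∑ a, π s a = 1) ∧
      ∀ p : M.StAct, x p = stateFreq x y p.1.1 * π p.1.1 p.1.2 := by
  classical
  set f : S → A → ℝ := fun s a => if h : M.Enabled s a then x ⟨(s, a), h⟩ else 0 with hf
  have hf0 : ∀ s a, 0 ≤ f s a := fun s a => by
    simp only [hf]
    split_ifs
    · exact h.nonneg _
    · exact le_rfl
  have hfx : ∀ p : M.StAct, x p = f p.1.1 p.1.2 := fun p => by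
    have := p.2
    simp [hf, this]
  have hsum : ∀ s, ¬ M.IsTerminal s → ∑ a, f s a = stateFreq x y s := by
    intro s hs
    rw [stateFreq, dif_neg hs, ← sum_stAct_fiber (M := M) (f := f) fun s a h => by simp [hf, h]]
    exact Finset.sum_congr rfl fun p _ => by rw [hfx p]
  have hex : ∀ s, ∃ ρ : A → ℝ, (∀ a, 0 ≤ ρ a) ∧ (∀ a, ρ a ≠ 0 → M.Enabled s a) ∧
      (¬ M.IsTerminal s → ∑ a, ρ a = 1) ∧
      ∀ a, M.Enabled s a → f s a = stateFreq x y s * ρ a := by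
    intro s
    by_cases hs : M.IsTerminal s
    · exact ⟨fun _ => 0, by simp, by simp, by simp [hs], fun a ha => absurd ha (hs a)⟩
    · by_cases hz : stateFreq x y s = 0
      -- In a state of frequency zero all the `f s a` vanish, so any distribution on enabled actions
      -- fits.
      · obtain ⟨a₀, ha₀⟩ := not_forall_not.1 hs
        refine ⟨fun a => if a = a₀ then 1 else 0, fun a => by dsimp only; split_ifs <;> simp,
          fun a ha => ?_, fun _ => by simp, fun a _ => ?_⟩
        · by_cases e : a = a₀
          · exact e ▸ ha₀
          · simp [e] at ha
        · rw [hz, zero_mul]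
          rw [← hsum s hs, Finset.sum_eq_zero_iff_of_nonneg fun a _ => hf0 s a] at hz
          exact hz a (Finset.mem_univ a)
      · refine ⟨fun a => f s a / stateFreq x y s,
          fun a => div_nonneg (hf0 s a) (h.stateFreq_nonneg s), fun a ha => ?_, fun _ => ?_,
          fun a _ => ?_⟩
        · by_contra hne
          simp [hf, hne] at ha
        · rw [← Finset.sum_div, hsum s hs, div_self hz]
        · field_simp
  choose π h0 h1 h2 h3 using hex
  exact ⟨π, h0, h1, h2, fun p => (hfx p).trans (h3 p.1.1 p.1.2 p.2)⟩

/-- In an MDP with a potential, every solution of the flow balance equations consists of the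
expected frequencies of some policy. -/
theorem exists_policy_of_isFreqSolution {w : S → ℝ} (hw : M.IsPotential w) {x : M.StAct → ℝ}
    {y : M.Terminal → ℝ} (h : IsFreqSolution x y) :
    ∃ σ : M.Policy, ∀ t, y t = (σ.pathMeasure M.init).real (eventually A {t.1}) := by
  classical
  obtain ⟨π, h0, h1, h2, h3⟩ := exists_stationary_probabilities h
  set σ := stationary π h0 h1 h2 with hσ
  refine ⟨σ, ?_⟩
  have h' := σ.isFreqSolution hw
  set x' : M.StAct → ℝ := fun p => σ.totalFreq M.init p.1.1 p.1.2 with hx'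
  set y' : M.Terminal → ℝ := fun t => (σ.pathMeasure M.init).real (eventually A {t.1}) with hy'
  have h3' : ∀ p : M.StAct, x' p = stateFreq x' y' p.1.1 * π p.1.1 p.1.2 := by
    intro p
    have hp : ¬ M.IsTerminal p.1.1 := fun ht => ht _ p.2
    rw [stateFreq, dif_neg hp, sum_stAct_fiber (f := fun t a => σ.totalFreq M.init t a)
        fun t a h => σ.totalFreq_eq_zero _ h, ← (σ.hasSum_occ M.init hw hp).tsum_eq]
    exact stationary_totalFreq _ _ _
  have bal : ∀ {x y}, IsFreqSolution x y →
      (∀ p : M.StAct, x p = stateFreq x y p.1.1 * π p.1.1 p.1.2) →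
      ∀ s, stateFreq x y s = (if s = M.init then 1 else 0) +
        ∑ t, ∑ a, stateFreq x y t * π t a * M.P t a s := by
    intro x y h h3 s
    rw [h.stateFreq_eq s, ← sum_stAct (f := fun t a => stateFreq x y t * π t a * M.P t a s)]
    · congr 1
      exact Finset.sum_congr rfl fun p _ => by rw [h3 p]
    · intro t a hta
      have : π t a = 0 := by
        by_contra hne
        exact hta (h1 t a hne)
      simp [this]
  have heq : ∀ p, x p = x' p := fun p => by
    rw [h3 p, h3' p, eq_of_balanced hw h0 h1 h2 (fun s _ => bal h h3 s) (fun s _ => bal h' h3' s)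
      fun ht => ht _ p.2]
  intro t
  change y t = y' t
  -- A terminal frequency equals the initial mass plus the inflow, which depends on `x` alone.
  rw [← stateFreq_terminal x y t, ← stateFreq_terminal x' y' t, h.stateFreq_eq, h'.stateFreq_eq]
  simp only [heq]

end Frequencies

/-! ### A potential from the absence of end components. -/

section Potential

variable {S A : Type*} [Fintype S] [Fintype A] {M : MDP S A}

theorem Enabled.exists_pos {s : S} {a : A} (h : M.Enabled s a) : ∃ t, 0 < M.P s a t := by
  by_contra! hn
  have : ∑ t, M.P s a t = 1 := h
  linarith [Finset.sum_nonpos fun t (_ : t ∈ Finset.univ) => hn t]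

theorem IsEC.exists_action {T : Set S} {B : Set (S × A)} (h : M.IsEC T B) {s : S} (hs : s ∈ T) :
    ∃ a, (s, a) ∈ B := by
  obtain ⟨p, hp⟩ := h.nonempty
  rcases (h.conn s hs p.1 (h.mem p hp)).cases_head with e | ⟨u, ⟨a, ha, -⟩, -⟩
  · exact ⟨p.2, e ▸ hp⟩
  · exact ⟨a, ha⟩

theorem IsEC.not_isTerminal {T : Set S} {B : Set (S × A)} (h : M.IsEC T B) {s : S} (hs : s ∈ T) :
    ¬ M.IsTerminal s := fun ht => by
  obtain ⟨a, ha⟩ := h.exists_action hs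
  exact ht a (h.enabled _ ha)

/-- If every state of a nonempty set has an action that stays in the set, then there is an end
component. -/
theorem exists_isEC_of_trap {U : Set S} (hU : U.Nonempty)
    (h : ∀ s ∈ U, ∃ a, M.Enabled s a ∧ ∀ t, 0 < M.P s a t → t ∈ U) : ∃ T B, M.IsEC T B := by
  classical
  obtain ⟨s₀, hs₀⟩ := hU
  have h' : ∀ s, ∃ a, s ∈ U → M.Enabled s a ∧ ∀ t, 0 < M.P s a t → t ∈ U := by
    intro s
    by_cases hs : s ∈ U
    · obtain ⟨a, ha⟩ := h s hs
      exact ⟨a, fun _ => ha⟩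
    · exact ⟨(h s₀ hs₀).choose, fun h => absurd h hs⟩
  choose f hf using h'
  set r : S → S → Prop := fun u v => 0 < M.P u (f u) v with hr
  set reach : S → Set S := fun u => {v | Relation.ReflTransGen r u v} with hreach
  -- With one staying action fixed per state, a smallest reachable set is strongly connected: every
  -- state in it reaches a subset that cannot be smaller.
  obtain ⟨u, hu, hmin⟩ := Set.exists_min_image U (fun u => (reach u).ncard) U.toFinite ⟨s₀, hs₀⟩
  have hsub : ∀ v ∈ reach u, v ∈ U := by
    intro v hv
    change Relation.ReflTransGen r u v at hv
    induction hv with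
    | refl => exact hu
    | tail _ hbc ih => exact (hf _ ih).2 _ hbc
  have hback : ∀ v ∈ reach u, reach v = reach u := fun v hv =>
    Set.eq_of_subset_of_ncard_le (fun z hz => Relation.ReflTransGen.trans hv hz)
      (hmin v (hsub v hv)) (Set.toFinite _)
  refine ⟨reach u, {p | p.1 ∈ reach u ∧ p.2 = f p.1}, ⟨(u, f u), Relation.ReflTransGen.refl, rfl⟩,
    fun p hp => hp.1, ?_, ?_, ?_⟩
  · rintro ⟨s, a⟩ ⟨hs, ha⟩
    obtain rfl : a = f s := ha
    exact (hf s (hsub s hs)).1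
  · rintro ⟨s, a⟩ ⟨hs, ha⟩ t ht
    obtain rfl : a = f s := ha
    exact Relation.ReflTransGen.tail hs ht
  · intro s hs t ht
    rw [← hback s hs] at ht
    change Relation.ReflTransGen r s t at ht
    induction ht with
    | refl => exact Relation.ReflTransGen.refl
    | tail hab hbc ih =>
      exact ih.tail ⟨_, ⟨Relation.ReflTransGen.trans hs hab, rfl⟩, hbc⟩

variable (M) in
/-- The states from which a state without enabled actions is reached with positive probability
within fewer than `k` steps, whatever actions are chosen. -/
def attractor : ℕ → Set S
  | 0 => ∅
  | k + 1 => {s | ∀ a, M.Enabled s a → ∃ t ∈ attractor k, 0 < M.P s a t}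

theorem attractor_mono : Monotone M.attractor := by
  refine monotone_nat_of_le_succ fun k => ?_
  induction k with
  | zero => exact Set.empty_subset _
  | succ k ih =>
    intro s hs a ha
    obtain ⟨t, ht, hp⟩ := hs a ha
    exact ⟨t, ih ht, hp⟩

/-- The increasing chain of attractors stabilises in a finite state space. Every state outside the
limit has an action that stays outside, so a nonempty complement would contain an end component. -/
theorem exists_attractor_eq_univ (h : ∀ T B, ¬ M.IsEC T B) : ∃ n, M.attractor n = Set.univ := by
  obtain ⟨n, hn⟩ := WellFoundedGT.monotone_chain_condition ⟨M.attractor, attractor_mono⟩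
  refine ⟨n, ?_⟩
  by_contra hne
  obtain ⟨T, B, hTB⟩ := exists_isEC_of_trap (M := M) (U := (M.attractor n)ᶜ)
    (Set.nonempty_compl.2 hne) fun s hs => by
      have hs' : s ∉ M.attractor (n + 1) := by
        have e : M.attractor n = M.attractor (n + 1) := hn (n + 1) n.le_succ
        rwa [← e]
      simp only [attractor, Set.mem_ofPred_eq, not_forall] at hs'
      obtain ⟨a, ha, hp⟩ := hs'
      exact ⟨a, ha, fun t ht htn => hp ⟨t, htn, ht⟩⟩
  exact h T B hTB

variable (M) in
theorem exists_pos_le_P : ∃ p : ℝ, 0 < p ∧ p ≤ 1 ∧ ∀ s a t, 0 < M.P s a t → p ≤ M.P s a t := by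
  classical
  -- The index `none` with value 1 makes the index type nonempty and the minimum at most 1.
  set g : Option (S × A × S) → ℝ := fun o => o.elim 1
    fun i => if 0 < M.P i.1 i.2.1 i.2.2 then M.P i.1 i.2.1 i.2.2 else 1 with hg
  obtain ⟨i, hi⟩ := Finite.exists_min g
  refine ⟨g i, ?_, hi none, fun s a t h => ?_⟩
  · rcases i with _ | i
    · exact one_pos
    · simp only [hg, Option.elim_some]
      split_ifs with h
      · exact h
      · exact one_pos
  · have := hi (some (s, a, t))
    simpa [hg, h] using this

/-- An MDP without end components has a potential. -/
theorem exists_isPotential (h : ∀ T B, ¬ M.IsEC T B) : ∃ w, M.IsPotential w := by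
  classical
  obtain ⟨n, hn⟩ := exists_attractor_eq_univ h
  obtain ⟨p, hp0, hp1, hp⟩ := exists_pos_le_P M
  -- `p` bounds the positive transition probabilities from below. From rank `k + 1`, an action
  -- enters rank at most `k` with probability at least `p`, and elsewhere `H` is at least 0. The
  -- recursion makes this one contribution pay for the unit drop.
  obtain ⟨H, hH0, hH⟩ : ∃ H : ℕ → ℝ, H 0 = 0 ∧ ∀ k, p * H (k + 1) = 1 + H k :=
    ⟨fun k => Nat.rec 0 (fun _ x => (1 + x) / p) k, rfl, fun k => by
      dsimp only
      field_simp⟩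
  have hHn : ∀ k, 0 ≤ H k := by
    intro k
    induction k with
    | zero => rw [hH0]
    | succ k ih =>
      have : 0 < p * H (k + 1) := by rw [hH]; linarith
      exact (pos_of_mul_pos_right this hp0.le).le
  have hmono : Monotone H := monotone_nat_of_le_succ fun k => by
    nlinarith [hH k, hHn (k + 1)]
  have hex : ∀ s, ∃ k, s ∈ M.attractor k := fun s => ⟨n, hn ▸ Set.mem_univ s⟩
  set r : S → ℕ := fun s => Nat.find (hex s) with hr
  have hrn : ∀ s, r s ≤ n := fun s => Nat.find_min' (hex s) (hn ▸ Set.mem_univ s)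
  refine ⟨fun s => H n - H (n - r s), fun s => sub_nonneg.2 (hmono (Nat.sub_le _ _)),
    fun s a ha => ?_⟩
  have hrs : s ∈ M.attractor (r s) := Nat.find_spec (hex s)
  obtain ⟨k, hk⟩ : ∃ k, r s = k + 1 := by
    refine Nat.exists_eq_succ_of_ne_zero fun h0 => ?_
    rw [h0] at hrs
    exact hrs
  rw [hk] at hrs
  obtain ⟨t, htk, ht⟩ := hrs a ha
  have hrt : r t ≤ k := Nat.find_min' (hex t) htk
  have hsum : ∑ t, M.P s a t = 1 := ha
  have h1 : p * H (n - k) ≤ ∑ t, M.P s a t * H (n - r t) := by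
    calc p * H (n - k) ≤ M.P s a t * H (n - r t) :=
          mul_le_mul (hp s a t ht) (hmono (by omega)) (hHn _) ht.le
      _ ≤ _ := Finset.single_le_sum (f := fun t => M.P s a t * H (n - r t))
          (fun t _ => mul_nonneg (M.P_nonneg _ _ _) (hHn _)) (Finset.mem_univ t)
  have h2 := hH (n - r s)
  rw [show n - r s + 1 = n - k by have := hrn s; omega] at h2
  simp only [mul_sub, Finset.sum_sub_distrib, ← Finset.sum_mul, hsum]
  linarith

end Potential

/-! ### Maximal end components and their quotient. -/

section Quotient

variable {S A : Type*} [Fintype S] [Fintype A] {M : MDP S A}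

theorem IsEC.exists_isMEC {T : Set S} {B : Set (S × A)} (h : M.IsEC T B) :
    ∃ T' B', M.IsMEC T' B' ∧ T ⊆ T' ∧ B ⊆ B' := by
  obtain ⟨⟨T', B'⟩, hle, hmax⟩ :=
    (Set.toFinite {p : Set S × Set (S × A) | M.IsEC p.1 p.2}).exists_le_maximal
      (a := (T, B)) h
  refine ⟨T', B', ⟨hmax.1, fun T₂ B₂ h₂ hT hB => ?_⟩, hle.1, hle.2⟩
  have := hmax.2 (y := (T₂, B₂)) h₂ ⟨hT, hB⟩
  exact ⟨this.1.antisymm hT, this.2.antisymm hB⟩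

theorem toQuot_eq {s t : S} :
    M.toQuot s = M.toQuot t ↔ s = t ∨ ∃ T B, M.IsMEC T B ∧ s ∈ T ∧ t ∈ T :=
  Quotient.eq

theorem eq_of_toQuot_eq_of_forall_not_mem {s t : S} (ht : ∀ T B, M.IsEC T B → t ∉ T)
    (h : M.toQuot s = M.toQuot t) : s = t := by
  rcases toQuot_eq.1 h with h | ⟨T, B, hm, -, h⟩
  · exact h
  · exact absurd h (ht T B hm.1)

theorem IsTerminal.eq_of_toQuot_eq {s t : S} (ht : M.IsTerminal t)
    (h : M.toQuot s = M.toQuot t) : s = t :=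
  eq_of_toQuot_eq_of_forall_not_mem (fun _ _ hEC hmem => hEC.not_isTerminal hmem ht) h

theorem IsMECClass.exists_mem {s : S} (h : M.IsMECClass (M.toQuot s)) :
    ∃ T B, M.IsMEC T B ∧ s ∈ T := by
  obtain ⟨T, B, hm, t, ht, e⟩ := h
  rcases toQuot_eq.1 e with rfl | ⟨T', B', hm', -, hs⟩
  · exact ⟨T, B, hm, ht⟩
  · exact ⟨T', B', hm', hs⟩

theorem InMEC.isMECClass {s : S} {a : A} (h : M.InMEC s a) : M.IsMECClass (M.toQuot s) := by
  obtain ⟨T, B, hm, hb⟩ := h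
  exact ⟨T, B, hm, s, hm.1.mem _ hb, rfl⟩

theorem mecQuotient_P_pos {q q' : M.MecQuot} {b : S × A} :
    0 < M.mecQuotient.P q b q' ↔
      (M.toQuot b.1 = q ∧ ¬ M.InMEC b.1 b.2) ∧ ∃ t, M.toQuot t = q' ∧ 0 < M.P b.1 b.2 t := by
  classical
  simp only [mecQuotient]
  split_ifs with h
  · rw [Finset.sum_pos_iff_of_nonneg]
    · simp only [h, true_and, not_false_eq_true, and_self, Finset.mem_univ]
      refine exists_congr fun t => ?_
      split_ifs with ht <;> simp [ht]
    · intro t _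
      split_ifs
      · exact M.P_nonneg _ _ _
      · exact le_rfl
  · simp [h]

theorem mecQuotient_P_sum {q : M.MecQuot} {b : S × A} (h : M.toQuot b.1 = q)
    (h' : ¬ M.InMEC b.1 b.2) : ∑ q', M.mecQuotient.P q b q' = ∑ t, M.P b.1 b.2 t := by
  classical
  simp only [mecQuotient, h, h', not_false_eq_true, and_self, if_true]
  rw [Finset.sum_comm]
  simp

end Quotient

/-! ### Structure of the canonical MDP. -/

section Canonical

variable {S A : Type*} [Fintype S] [Fintype A] {M : MDP S A} {C E : Set S}

theorem collapse_eq_inl {q : M.CanQuot C E} {z : {q : M.CanQuot C E // ¬ M.IsTerminalClass C E q}} :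
    M.collapse C E q = .inl z ↔ q = z.1 := by
  unfold collapse
  split_ifs with h
  · simp only [false_iff]
    rintro rfl
    exact z.2 h
  · simp [Subtype.ext_iff]

theorem collapse_eq_inr {q : M.CanQuot C E} {o : Outcome} :
    M.collapse C E q = .inr o ↔ M.IsTerminalClass C E q ∧ M.outcome C E q = o := by
  unfold collapse
  split_ifs with h <;> simp [h]

theorem canonical_P_inr (o : Outcome) (a : Option ((S ⊕ Verdict) × (A ⊕ Choice)))
    (z : M.CanState C E) : (M.canonical C E).P (.inr o) a z = 0 := rfl

theorem canonical_P_some_pos {q : {q : M.CanQuot C E // ¬ M.IsTerminalClass C E q}}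
    {b : (S ⊕ Verdict) × (A ⊕ Choice)} {z : M.CanState C E} :
    0 < (M.canonical C E).P (.inl q) (some b) z ↔
      ((M.minMax C E).toQuot b.1 = q.1 ∧ ¬ (M.minMax C E).InMEC b.1 b.2) ∧
        ∃ t, M.collapse C E ((M.minMax C E).toQuot t) = z ∧ 0 < (M.minMax C E).P b.1 b.2 t := by
  classical
  have e : (M.canonical C E).P (.inl q) (some b) z =
    ∑ q', if M.collapse C E q' = z then (M.minMax C E).mecQuotient.P q.1 b q' else 0 := rfl
  rw [e, Finset.sum_pos_iff_of_nonneg]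
  · constructor
    · rintro ⟨q', -, h⟩
      split_ifs at h with hz
      · obtain ⟨h1, t, rfl, ht⟩ := mecQuotient_P_pos.1 h
        exact ⟨h1, t, hz, ht⟩
      · exact absurd h (lt_irrefl _)
    · rintro ⟨h1, t, rfl, ht⟩
      refine ⟨(M.minMax C E).toQuot t, Finset.mem_univ _, ?_⟩
      rw [if_pos rfl]
      exact mecQuotient_P_pos.2 ⟨h1, t, rfl, ht⟩
  · intro q' _
    split_ifs
    · exact MDP.P_nonneg _ _ _ _
    · exact le_rfl

theorem canonical_P_none_pos {q : {q : M.CanQuot C E // ¬ M.IsTerminalClass C E q}}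
    {z : M.CanState C E} :
    0 < (M.canonical C E).P (.inl q) none z ↔
      (M.minMax C E).IsMECClass q.1 ∧ z = .inr .TN := by
  have e : (M.canonical C E).P (.inl q) none z =
    open Classical in if (M.minMax C E).IsMECClass q.1 ∧ z = .inr .TN then 1 else 0 := rfl
  rw [e]
  split_ifs with h <;> simp [h]

theorem canonical_enabled_some {q : {q : M.CanQuot C E // ¬ M.IsTerminalClass C E q}}
    {b : (S ⊕ Verdict) × (A ⊕ Choice)} :
    (M.canonical C E).Enabled (.inl q) (some b) ↔
      ((M.minMax C E).toQuot b.1 = q.1 ∧ ¬ (M.minMax C E).InMEC b.1 b.2) ∧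
        (M.minMax C E).Enabled b.1 b.2 := by
  classical
  have e : ∑ z, (M.canonical C E).P (.inl q) (some b) z =
      ∑ q', (M.minMax C E).mecQuotient.P q.1 b q' := by
    have e' : ∀ z, (M.canonical C E).P (.inl q) (some b) z =
      ∑ q', if M.collapse C E q' = z then (M.minMax C E).mecQuotient.P q.1 b q' else 0 :=
      fun _ => rfl
    simp_rw [e']
    rw [Finset.sum_comm]
    simp
  constructor
  · intro h
    obtain ⟨z, hz⟩ := h.exists_pos
    obtain ⟨h1, -⟩ := canonical_P_some_pos.1 hz
    refine ⟨h1, ?_⟩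
    rw [Enabled, ← mecQuotient_P_sum h1.1 h1.2, ← e]
    exact h
  · rintro ⟨h1, h2⟩
    rw [Enabled, e, mecQuotient_P_sum h1.1 h1.2]
    exact h2

theorem canonical_enabled_none {q : {q : M.CanQuot C E // ¬ M.IsTerminalClass C E q}}
    (h : (M.minMax C E).IsMECClass q.1) : (M.canonical C E).Enabled (.inl q) none := by
  classical
  have e' : ∀ z, (M.canonical C E).P (.inl q) none z =
    if (M.minMax C E).IsMECClass q.1 ∧ z = .inr .TN then 1 else 0 := fun _ => rfl
  rw [Enabled]
  simp_rw [e']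
  simp [h]

/-- The terminal states of the canonical MDP are `TP`, `FP`, `FN` and `TN`. -/
theorem canonical_isTerminal_inr (o : Outcome) : (M.canonical C E).IsTerminal (.inr o) := by
  intro a h
  obtain ⟨z, hz⟩ := h.exists_pos
  rw [canonical_P_inr] at hz
  exact lt_irrefl _ hz

theorem canonical_not_isTerminal_inl (q : {q : M.CanQuot C E // ¬ M.IsTerminalClass C E q}) :
    ¬ (M.canonical C E).IsTerminal (.inl q) := by
  obtain ⟨q, hq⟩ := q
  obtain ⟨s, rfl⟩ : ∃ s, (M.minMax C E).toQuot s = q := Quotient.exists_rep q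
  intro ht
  by_cases hm : (M.minMax C E).IsMECClass ((M.minMax C E).toQuot s)
  · exact ht none (canonical_enabled_none hm)
  · obtain ⟨a, ha⟩ := not_forall_not.1 fun h => hq ⟨s, h, rfl⟩
    exact ht (some (s, a)) (canonical_enabled_some.2 ⟨⟨rfl, fun h => hm h.isMECClass⟩, ha⟩)

/-- The canonical MDP has no end components. -/
theorem canonical_not_isEC (T : Set (M.CanState C E))
    (B : Set (M.CanState C E × Option ((S ⊕ Verdict) × (A ⊕ Choice)))) :
    ¬ (M.canonical C E).IsEC T B := by
  intro hEC
  set Q := M.minMax C E with hQ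
  have hT : ∀ z ∈ T, ∃ q, z = .inl q := by
    rintro (q | o) hz
    · exact ⟨q, rfl⟩
    · exact absurd (canonical_isTerminal_inr o) (hEC.not_isTerminal hz)
  -- The action `τ` cannot occur, since it leads to the terminal state `TN`, which lies in no end
  -- component.
  have hB : ∀ z a, (z, a) ∈ B → ∃ b, a = some b ∧ z = M.collapse C E (Q.toQuot b.1) ∧
      ¬ Q.InMEC b.1 b.2 ∧ Q.Enabled b.1 b.2 := by
    rintro z (_ | b) hza <;> obtain ⟨q, rfl⟩ := hT z (hEC.mem _ hza)
    · obtain ⟨z', hz'⟩ := (hEC.enabled _ hza).exists_pos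
      obtain ⟨-, rfl⟩ := canonical_P_none_pos.1 hz'
      obtain ⟨q', h⟩ := hT _ (hEC.closed _ hza _ hz')
      simp at h
    · have := canonical_enabled_some.1 (hEC.enabled _ hza)
      exact ⟨b, rfl, (collapse_eq_inl.2 this.1.1).symm, this.1.2, this.2⟩
  have hclass : ∀ s t, M.collapse C E (Q.toQuot s) ∈ T →
      M.collapse C E (Q.toQuot s) = M.collapse C E (Q.toQuot t) → Q.toQuot s = Q.toQuot t := by
    intro s t hs h
    obtain ⟨q, hq⟩ := hT _ hs
    have hq' := hq
    rw [h] at hq'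
    exact (collapse_eq_inl.1 hq).trans (collapse_eq_inl.1 hq').symm
  set T₀ : Set (S ⊕ Verdict) := {s | M.collapse C E (Q.toQuot s) ∈ T} with hT₀
  -- The end component is lifted to the MDP before the quotient: its own actions are kept, and the
  -- inner actions of the collapsed components are added to connect states of one class.
  set B₀ : Set ((S ⊕ Verdict) × (A ⊕ Choice)) :=
    {b | (M.collapse C E (Q.toQuot b.1), some b) ∈ B ∨ (b.1 ∈ T₀ ∧ Q.InMEC b.1 b.2)} with hB₀
  have hinner : ∀ s t, s ∈ T₀ → Q.toQuot s = Q.toQuot t →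
      Relation.ReflTransGen (fun u v => ∃ a, (u, a) ∈ B₀ ∧ 0 < Q.P u a v) s t := by
    intro s t hs hst
    rcases toQuot_eq.1 hst with rfl | ⟨T', B', hm, hs', ht'⟩
    · exact .refl
    · refine Relation.ReflTransGen.mono ?_ _ _ (hm.1.conn s hs' t ht')
      rintro u v ⟨a, ha, hp⟩
      refine ⟨a, Or.inr ⟨?_, T', B', hm, ha⟩, hp⟩
      have : Q.toQuot u = Q.toQuot s := toQuot_eq.2 (.inr ⟨T', B', hm, hm.1.mem _ ha, hs'⟩)
      simpa only [hT₀, Set.mem_ofPred_eq, this] using hs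
  have hEC₀ : Q.IsEC T₀ B₀ := by
    refine ⟨?_, ?_, ?_, ?_, ?_⟩
    · obtain ⟨⟨z, a⟩, hp⟩ := hEC.nonempty
      obtain ⟨b, rfl, rfl, -⟩ := hB z a hp
      exact ⟨b, Or.inl hp⟩
    · rintro b (hb | hb)
      · exact hEC.mem _ hb
      · exact hb.1
    · rintro b (hb | ⟨-, T', B', hm, hb⟩)
      · obtain ⟨b', e, -, -, h⟩ := hB _ _ hb
        obtain rfl := Option.some.inj e
        exact h
      · exact hm.1.enabled _ hb
    · rintro b (hb | ⟨hb, T', B', hm, hb'⟩) t ht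
      · refine hEC.closed _ hb _ ?_
        obtain ⟨q, hq⟩ := hT _ (hEC.mem _ hb)
        obtain ⟨b', e, -, hn, -⟩ := hB _ _ hb
        obtain rfl := Option.some.inj e
        change 0 < (M.canonical C E).P (M.collapse C E (Q.toQuot b.1)) (some b) _
        have hq : M.collapse C E (Q.toQuot b.1) = .inl q := hq
        rw [hq]
        exact canonical_P_some_pos.2 ⟨⟨collapse_eq_inl.1 hq, hn⟩, t, rfl, ht⟩
      · have : Q.toQuot t = Q.toQuot b.1 :=
          toQuot_eq.2 (.inr ⟨T', B', hm, hm.1.closed _ hb' _ ht, hm.1.mem _ hb'⟩)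
        simpa only [hT₀, Set.mem_ofPred_eq, this] using hb
    · have hpath : ∀ s ∈ T₀, ∀ z, Relation.ReflTransGen
          (fun u v => ∃ a, (u, a) ∈ B ∧ 0 < (M.canonical C E).P u a v)
          (M.collapse C E (Q.toQuot s)) z → ∀ t, M.collapse C E (Q.toQuot t) = z →
          Relation.ReflTransGen (fun u v => ∃ a, (u, a) ∈ B₀ ∧ 0 < Q.P u a v) s t := by
        intro s hs z hz
        induction hz with
        | refl => exact fun t ht => hinner s t hs (hclass s t hs ht.symm)
        | @tail u v _ huv ih =>
          intro t ht
          obtain ⟨a, ha, hp⟩ := huv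
          obtain ⟨b, rfl, rfl, hn, -⟩ := hB _ _ ha
          have hv := hEC.closed _ ha v hp
          obtain ⟨q, hq⟩ := hT _ (hEC.mem _ ha)
          have hq : M.collapse C E (Q.toQuot b.1) = .inl q := hq
          rw [hq] at hp
          obtain ⟨-, t', ht', hpt⟩ := canonical_P_some_pos.1 hp
          -- A quotient step lifts to three moves: reach the state that owns the action, take it,
          -- then travel inside the class entered.
          refine ((ih b.1 rfl).tail ⟨b.2, Or.inl ha, hpt⟩).trans ?_
          have h' : t' ∈ T₀ := by
            rw [← ht'] at hv
            exact hv
          exact hinner t' t h' (hclass t' t h' (ht'.trans ht.symm))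
      exact fun s hs t ht => hpath s hs _ (hEC.conn _ hs _ ht) t rfl
  -- The lift lies in a maximal end component. It contains an action of the quotient, but those are
  -- exactly outside all maximal end components.
  obtain ⟨T', B', hm, -, hBB⟩ := hEC₀.exists_isMEC
  obtain ⟨⟨z, a⟩, hp⟩ := hEC.nonempty
  obtain ⟨b, rfl, rfl, hn, -⟩ := hB z a hp
  exact hn ⟨T', B', hm, hBB (Or.inl hp)⟩

theorem sum_verdict (f : Verdict → ℝ) : ∑ v, f v = f .TP + f .FP := by
  change (Multiset.map f ([Verdict.TP, Verdict.FP] : List Verdict)).sum = _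
  simp

theorem minMax_isTerminal_inr (v : Verdict) : (M.minMax C E).IsTerminal (.inr v) := by
  rintro (a | m) h <;> simp [Enabled, minMax, minMaxP] at h

theorem minMax_P_inr_pos {s : S ⊕ Verdict} {a : A ⊕ Choice} {v : Verdict}
    (h : 0 < (M.minMax C E).P s a (.inr v)) : ∃ c ∈ C, s = .inl c := by
  rcases s with s | w <;> rcases a with a | m <;> rcases v with _ | _ <;>
    simp only [minMax, minMaxP, lt_irrefl] at h
  all_goals
    split_ifs at h with hs
    · exact ⟨s, hs, rfl⟩
    · exact absurd h (lt_irrefl _)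

theorem minMax_P_inl_pos {c : S} (hc : c ∈ C) {a : A ⊕ Choice} {t : S ⊕ Verdict}
    (h : 0 < (M.minMax C E).P (.inl c) a t) : ∃ v, t = .inr v := by
  rcases t with t | v
  · rcases a with a | m <;> simp [minMax, minMaxP, hc] at h
  · exact ⟨v, rfl⟩

/-- Every action of a state of `C` leads to a fresh terminal state, which no end component contains.
Hence states of `C` are neither merged with others nor given the action `τ`. -/
theorem minMax_not_mem_of_isEC {c : S} (hc : c ∈ C) {T : Set (S ⊕ Verdict)}
    {B : Set ((S ⊕ Verdict) × (A ⊕ Choice))} (h : (M.minMax C E).IsEC T B) : .inl c ∉ T := by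
  intro hT
  obtain ⟨a, ha⟩ := h.exists_action hT
  obtain ⟨t, ht⟩ := (h.enabled _ ha).exists_pos
  obtain ⟨v, rfl⟩ := minMax_P_inl_pos hc ht
  exact h.not_isTerminal (h.closed _ ha _ ht) (minMax_isTerminal_inr v)

theorem minMax_not_isTerminal {c : S} (hc : c ∈ C) : ¬ (M.minMax C E).IsTerminal (.inl c) := by
  intro h
  refine h (.inr .min) ?_
  simp [Enabled, minMax, minMaxP, hc, sum_verdict]

theorem eq_of_toQuot_eq_inl {c : S} (hc : c ∈ C) {s : S ⊕ Verdict}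
    (h : (M.minMax C E).toQuot s = (M.minMax C E).toQuot (.inl c)) : s = .inl c :=
  eq_of_toQuot_eq_of_forall_not_mem (fun _ _ => minMax_not_mem_of_isEC hc) h

theorem not_isTerminalClass_inl {c : S} (hc : c ∈ C) :
    ¬ M.IsTerminalClass C E ((M.minMax C E).toQuot (.inl c)) := by
  rintro ⟨s, hs, h⟩
  rw [eq_of_toQuot_eq_inl hc h] at hs
  exact minMax_not_isTerminal hc hs

/-- The outcome that corresponds to a terminal state of the first step. -/
def Verdict.toOutcome : Verdict → Outcome
  | .TP => .TP
  | .FP => .FP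

theorem outcome_eq_toOutcome {q : M.CanQuot C E} {v : Verdict} :
    M.outcome C E q = v.toOutcome ↔ q = (M.minMax C E).toQuot (.inr v) := by
  have hne : (M.minMax C E).toQuot (.inr .FP) ≠ (M.minMax C E).toQuot (.inr .TP) := fun h => by
    have := (minMax_isTerminal_inr .TP).eq_of_toQuot_eq h
    simp at this
  unfold outcome
  rcases v with _ | _ <;> simp only [Verdict.toOutcome] <;> split_ifs with h1 h2 h3 <;>
    simp_all [hne.symm]

theorem collapse_eq_toOutcome {s : S ⊕ Verdict} {v : Verdict} :
    M.collapse C E ((M.minMax C E).toQuot s) = .inr v.toOutcome ↔ s = .inr v := by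
  rw [collapse_eq_inr, outcome_eq_toOutcome]
  constructor
  · exact fun h => (minMax_isTerminal_inr v).eq_of_toQuot_eq h.2
  · rintro rfl
    exact ⟨⟨_, minMax_isTerminal_inr v, rfl⟩, rfl⟩

theorem canonical_init_ne (v : Verdict) : (M.canonical C E).init ≠ .inr v.toOutcome := by
  intro h
  have : M.collapse C E ((M.minMax C E).toQuot (.inl M.init)) = .inr v.toOutcome := h
  simp [collapse_eq_toOutcome] at this

/-- `TP` and `FP` are entered from `C` only. -/
theorem mem_canonicalC_of_P_pos {z : M.CanState C E}
    {a : Option ((S ⊕ Verdict) × (A ⊕ Choice))} {v : Verdict}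
    (h : 0 < (M.canonical C E).P z a (.inr v.toOutcome)) : z ∈ M.canonicalC C E := by
  rcases z with q | o
  · rcases a with _ | b
    · have := (canonical_P_none_pos.1 h).2
      cases v <;> simp [Verdict.toOutcome] at this
    · obtain ⟨⟨hb, -⟩, t, ht, hp⟩ := canonical_P_some_pos.1 h
      rw [collapse_eq_toOutcome] at ht
      subst ht
      obtain ⟨c, hc, e⟩ := minMax_P_inr_pos hp
      refine ⟨c, hc, ?_⟩
      rw [← e]
      exact (collapse_eq_inl.2 hb).symm
  · rw [canonical_P_inr] at h
    exact absurd h (lt_irrefl _)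

theorem not_isTerminal_of_mem_canonicalC {z : M.CanState C E} (hz : z ∈ M.canonicalC C E) :
    ¬ (M.canonical C E).IsTerminal z := by
  obtain ⟨c, hc, rfl⟩ := hz
  rw [collapse, dif_neg (not_isTerminalClass_inl hc)]
  exact canonical_not_isTerminal_inl _

/-- `C` is left to `TP` and `FP` only. -/
theorem eq_toOutcome_of_P_pos {z z' : M.CanState C E}
    {a : Option ((S ⊕ Verdict) × (A ⊕ Choice))} (hz : z ∈ M.canonicalC C E)
    (h : 0 < (M.canonical C E).P z a z') : ∃ v : Verdict, z' = .inr v.toOutcome := by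
  obtain ⟨c, hc, rfl⟩ := hz
  rw [collapse, dif_neg (not_isTerminalClass_inl hc)] at h
  rcases a with _ | b
  · obtain ⟨T, B, hm, hT⟩ := (canonical_P_none_pos.1 h).1.exists_mem
    exact absurd hT (minMax_not_mem_of_isEC hc hm.1)
  · obtain ⟨⟨hb, -⟩, t, rfl, hp⟩ := canonical_P_some_pos.1 h
    rw [eq_of_toQuot_eq_inl hc hb] at hp
    obtain ⟨v, rfl⟩ := minMax_P_inl_pos hc hp
    exact ⟨v, collapse_eq_toOutcome.2 rfl⟩

end Canonical

/-! ### Outcome probabilities and the GPR condition. -/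

section GPR

variable {S A : Type*} [Fintype S] [Fintype A] {M : MDP S A} {C E : Set S}

omit [Fintype S] [Fintype A] in
theorem measurableSet_eventually (T : Set S) : MeasurableSet (eventually A T) := by
  have : eventually A T = ⋃ n, {ω : ℕ → PathStep S A | (ω n).state ∈ T} := by
    ext ω
    simp [eventually]
  rw [this]
  exact MeasurableSet.iUnion fun n => Policy.measurable_state n
    (MeasurableSet.of_discrete (s := {y : PathStep S A | y.state ∈ T}))

/-- Almost every run visits at most one terminal state. -/
theorem Policy.ae_eq_of_terminal (σ : M.Policy) (s₀ : S) :
    ∀ᵐ ω ∂σ.pathMeasure s₀, ∀ t t', M.IsTerminal t → M.IsTerminal t' →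
      ω ∈ eventually A {t} → ω ∈ eventually A {t'} → t = t' := by
  filter_upwards [σ.ae_transition s₀] with ω hω
  rintro t t' ht ht' ⟨n, hn⟩ ⟨n', hn'⟩
  have hn : (ω n).state = t := hn
  have hn' : (ω n').state = t' := hn'
  rw [← hn] at ht ⊢
  rw [← hn'] at ht' ⊢
  rcases le_total n n' with h | h
  · exact (state_eq_of_terminal hω h ht).symm
  · exact state_eq_of_terminal hω h ht'

theorem Policy.real_eventually_pair (σ : M.Policy) (s₀ : S) {t t' : S} (ht : M.IsTerminal t)
    (ht' : M.IsTerminal t') (hne : t ≠ t') :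
    (σ.pathMeasure s₀).real (eventually A {t, t'}) =
      (σ.pathMeasure s₀).real (eventually A {t}) + (σ.pathMeasure s₀).real (eventually A {t'}) := by
  have e : eventually A {t, t'} = eventually A {t} ∪ eventually A {t'} := by
    ext ω
    simp [eventually, exists_or]
  rw [e, measureReal_def, measure_union₀ (measurableSet_eventually _).nullMeasurableSet,
    ENNReal.toReal_add (measure_ne_top _ _) (measure_ne_top _ _)]
  · rfl
  · rw [AEDisjoint, measure_eq_zero_iff_ae_notMem]
    filter_upwards [σ.ae_eq_of_terminal s₀] with ω hω h
    exact hne (hω t t' ht ht' h.1 h.2)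

/-- A visit to `C` is followed by `TP` or `FP` in the next step. Conversely, the run does not start
in these states, so tracing back to the first entry finds a predecessor in `C`. -/
theorem ae_eventually_canonicalC (σ : (M.canonical C E).Policy) :
    ∀ᵐ ω ∂σ.pathMeasure (M.canonical C E).init,
      (ω ∈ eventually _ (M.canonicalC C E) ↔
        ω ∈ eventually _ {(.inr .TP : M.CanState C E), .inr .FP}) := by
  filter_upwards [σ.ae_transition _, σ.ae_init _] with ω hω h0
  constructor
  · rintro ⟨n, hn⟩
    rcases hω n with ⟨h, -⟩ | ⟨-, a, -, hp⟩
    · exact absurd h (not_isTerminal_of_mem_canonicalC hn)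
    · obtain ⟨v, hv⟩ := eq_toOutcome_of_P_pos hn hp
      exact ⟨n + 1, by cases v <;> simp [hv, Verdict.toOutcome]⟩
  · have key : ∀ n (v : Verdict), (ω n).state = .inr v.toOutcome →
        ω ∈ eventually _ (M.canonicalC C E) := by
      intro n v
      induction n with
      | zero =>
        intro h
        exact absurd (h0.symm.trans h) (canonical_init_ne v)
      | succ n ih =>
        intro h
        rcases hω n with ⟨-, e⟩ | ⟨-, a, -, hp⟩
        · exact ih (e.symm.trans h)
        · rw [h] at hp
          exact ⟨n, mem_canonicalC_of_P_pos hp⟩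
    rintro ⟨n, hn | hn⟩
    · exact key n .TP hn
    · exact key n .FP hn

theorem sum_outcome (f : Outcome → ℝ) : ∑ o, f o = f .TP + f .FP + f .FN + f .TN := by
  change (Multiset.map f ([Outcome.TP, Outcome.FP, Outcome.FN, Outcome.TN] : List Outcome)).sum = _
  simp
  ring

variable (M C E) in
/-- The terminal states of the canonical MDP correspond to the four outcomes. -/
noncomputable def outcomeEquiv : Outcome ≃ (M.canonical C E).Terminal where
  toFun o := ⟨.inr o, canonical_isTerminal_inr o⟩
  invFun t := match t with
    | ⟨.inr o, _⟩ => o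
    | ⟨.inl q, h⟩ => absurd h (canonical_not_isTerminal_inl q)
  left_inv _ := rfl
  right_inv := by
    rintro ⟨q | o, h⟩
    · exact absurd h (canonical_not_isTerminal_inl q)
    · rfl

theorem IsFreqSolution.sum_outcome {x : (M.canonical C E).StAct → ℝ}
    {y : (M.canonical C E).Terminal → ℝ} (h : IsFreqSolution x y) :
    stateFreq x y (.inr .TP) + stateFreq x y (.inr .FP) + stateFreq x y (.inr .FN) +
      stateFreq x y (.inr .TN) = 1 := by
  classical
  have : Fintype (M.canonical C E).Terminal := Fintype.ofFinite _
  rw [← MDP.sum_outcome fun o => stateFreq x y (.inr o), ← h.sum_terminal,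
    ← (outcomeEquiv M C E).sum_comp]
  exact Finset.sum_congr rfl fun o _ => stateFreq_terminal x y (outcomeEquiv M C E o)

/-- A policy of the canonical MDP is a GPR policy iff the probabilities of the four outcomes
satisfy the quadratic inequality. -/
theorem isGPR_canonical_iff (σ : (M.canonical C E).Policy) {p : Outcome → ℝ}
    (hp : ∀ o, p o = (σ.pathMeasure (M.canonical C E).init).real (eventually _ {.inr o}))
    (hsum : p .TP + p .FP + p .FN + p .TN = 1) :
    σ.IsGPR (M.canonicalC C E) (M.canonicalE C E) ↔ 0 < p .TP * p .TN - p .FP * p .FN := by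
  set μ := σ.pathMeasure (M.canonical C E).init with hμ
  have hp0 : ∀ o, 0 ≤ p o := fun o => (hp o).symm ▸ measureReal_nonneg
  have hpair : ∀ o o', o ≠ o' → μ.real (eventually _ {(.inr o : M.CanState C E), .inr o'}) =
      p o + p o' := fun o o' hne => by
    rw [hp, hp]
    exact σ.real_eventually_pair _ (canonical_isTerminal_inr o) (canonical_isTerminal_inr o')
      (by simpa using hne)
  have hC : μ.real (eventually _ (M.canonicalC C E)) = p .TP + p .FP := by
    rw [← hpair _ _ (by simp)]
    refine measureReal_congr ?_
    filter_upwards [ae_eventually_canonicalC σ] with ω hω using propext hω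
  have hE : μ.real (eventually _ (M.canonicalE C E)) = p .TP + p .FN := hpair _ _ (by simp)
  -- A run that visits `C` ends in `TP` or `FP`, and one that also visits `E` cannot pair `FP` with
  -- `FN`; only `TP` is left.
  have hCE : μ.real (eventually _ (M.canonicalC C E) ∩ eventually _ (M.canonicalE C E)) =
      p .TP := by
    rw [hp]
    refine measureReal_congr ?_
    filter_upwards [ae_eventually_canonicalC σ, σ.ae_eq_of_terminal _] with ω hω hω'
    have h := fun o o' h h' => Sum.inr_injective
      (hω' (.inr o) (.inr o') (canonical_isTerminal_inr o) (canonical_isTerminal_inr o') h h')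
    refine propext ⟨fun hm => ?_, fun hm => ⟨hω.2 ?_, ?_⟩⟩
    · obtain ⟨n, hn⟩ := hω.1 hm.1
      obtain ⟨k, hk⟩ := hm.2
      rcases hn with hn | hn
      · exact ⟨n, hn⟩
      · rcases hk with hk | hk
        · exact ⟨k, hk⟩
        · have := h .FP .FN ⟨n, hn⟩ ⟨k, hk⟩
          simp at this
    · exact hm.imp fun n hn => Or.inl hn
    · exact hm.imp fun n hn => Or.inl hn
  have hcond : (cond μ (eventually _ (M.canonicalC C E))).real
      (eventually _ (M.canonicalE C E)) = (p .TP + p .FP)⁻¹ * p .TP := by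
    rw [measureReal_def, cond_apply (measurableSet_eventually _), ENNReal.toReal_mul,
      ENNReal.toReal_inv, ← measureReal_def, ← measureReal_def, hC, hCE]
  have h1 : σ.IsGPR (M.canonicalC C E) (M.canonicalE C E) ↔
      0 < p .TP + p .FP ∧ p .TP + p .FN < (p .TP + p .FP)⁻¹ * p .TP := by
    rw [← hC, ← hE] at *
    rw [← hcond, Policy.IsGPR, measureReal_def, measureReal_def, measureReal_def,
      ENNReal.toReal_lt_toReal (measure_ne_top _ _) (measure_ne_top _ _),
      ENNReal.toReal_pos_iff]
    simp [measure_lt_top, hμ]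
  rw [h1]
  have h2 : 0 < p .TP + p .FP → (p .TP + p .FN < (p .TP + p .FP)⁻¹ * p .TP ↔
      0 < p .TP * p .TN - p .FP * p .FN) := by
    intro hpos
    -- Substituting for `p .TN` turns the cleared inequality into the quadratic one.
    rw [inv_mul_eq_div, lt_div_iff₀ hpos, show p .TN = 1 - p .TP - p .FP - p .FN by linarith,
      ← sub_pos]
    ring_nf
  constructor
  · exact fun h => (h2 h.1).1 h.2
  · intro h
    -- The quadratic inequality forces `p .TP > 0`, so positivity of the probability of `◇ C` need
    -- not be a separate constraint.
    have hpos : 0 < p .TP + p .FP := by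
      have hTP : 0 < p .TP * p .TN := by
        nlinarith [mul_nonneg (hp0 .FP) (hp0 .FN)]
      have := pos_of_mul_pos_left hTP (hp0 .TN)
      linarith [hp0 .FP]
    exact ⟨hpos, (h2 hpos).2 h⟩

end GPR

end MDP

/-! ### The equivalence. -/

theorem lemma18 {S A : Type*} [Fintype S] [Fintype A] (M : MDP S A) (C E : Set S)
    (hE : ∀ e ∈ E, M.IsTerminal e) (hCE : Disjoint C E) :
    (∃ σ : (M.canonical C E).Policy, σ.IsGPR (M.canonicalC C E) (M.canonicalE C E)) ↔
      ∃ (x : (M.canonical C E).StAct → ℝ) (y : (M.canonical C E).Terminal → ℝ),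
        MDP.IsFreqSolution x y ∧
        MDP.stateFreq x y (.inr .TP) * MDP.stateFreq x y (.inr .TN) -
          MDP.stateFreq x y (.inr .FP) * MDP.stateFreq x y (.inr .FN) > 0 := by
  obtain ⟨w, hw⟩ := MDP.exists_isPotential (M.canonical_not_isEC (C := C) (E := E))
  constructor
  · rintro ⟨σ, hσ⟩
    obtain ⟨x, y, h, hy⟩ : ∃ x y, MDP.IsFreqSolution x y ∧ ∀ t, y t =
        (σ.pathMeasure (M.canonical C E).init).real (MDP.eventually _ {t.1}) :=
      ⟨_, _, σ.isFreqSolution hw, fun _ => rfl⟩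
    refine ⟨x, y, h, (MDP.isGPR_canonical_iff σ (p := fun o => MDP.stateFreq x y (.inr o))
      (fun o => ?_) h.sum_outcome).1 hσ⟩
    exact (MDP.stateFreq_terminal x y (MDP.outcomeEquiv M C E o)).trans (hy _)
  · rintro ⟨x, y, h, hq⟩
    obtain ⟨σ, hσ⟩ := MDP.exists_policy_of_isFreqSolution hw h
    refine ⟨σ, (MDP.isGPR_canonical_iff σ (p := fun o => MDP.stateFreq x y (.inr o))
      (fun o => ?_) h.sum_outcome).2 hq⟩
    exact (MDP.stateFreq_terminal x y (MDP.outcomeEquiv M C E o)).trans (hσ _)
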